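/- **Setting.** Let $M$ be a smooth (Hausdorff, boundaryless, finite-dimensional) manifold with a $1$-form $\lambda$ such that $\omega=d\lambda$ is symplectic, let $H,g:M\to\mathbb R$ be smooth and let $J$ be a smooth almost complex structure on $M$. The Hamiltonian vector field $X_h$ of $h$ is given by $\omega(\cdot,X_h)=dh$. For an almost complex structure $K$ and a function $G$ put $d^cG=dG\circ K$ and $\omega_G=-d(d^cG)$. A function $h$ on $M$ is *$J$-convex* if $\omega_h(v,Jv)>0$ for all $v\neq0$; then $\|v\|_h=\sqrt{\omega_h(v,Jv)}$ is the norm of the metric $\frac12(\omega_h(v_1,Jv_2)+\omega_h(v_2,Jv_1))$ (the dual norm is used for $1$-forms), and $\eta_h(v_1,v_2)=\frac12(\omega_h(v_1,Jv_2)-\omega_h(v_2,Jv_1))$. A pair $(h,J')$ is *partial convex data* if $h$ is smooth and bounded below, $J'$ is a smooth almost complex structure, $h$ is $J'$-convex outside a compact set, $-d^ch=\lambda$ on $\{h>C\}$ for some $C>0$, and the Liouville field $Z$ ($\iota_Z\omega=\lambda$) and $-Z$ are complete. **Decorated pointed discs.** Let $D$ be the closed unit disc. A decorated pointed disc consists of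 $d+1$ distinct points $\zeta^0,\dots,\zeta^d\in\partial D$ in counter-clockwise order, with $S=D\setminus\{\zeta^0,\dots,\zeta^d\}$ and complex structure $j$; strip-like ends $\epsilon^i$, holomorphic embeddings into $S$ of $\mathbb R_{>0}\times[0,1]$ (of $\mathbb R_{<0}\times[0,1]$ for $i=0$), mapping $\mathbb R\times\{0,1\}$ into $\partial S$, with $\epsilon^i(s,\cdot)\to\zeta^i$ as $s\to\pm\infty$; weights $w^i\in\mathbb Z_{>0}$ with $w^0=\sum_{i\ge1}w^i$; a smooth $1$-form $\gamma$ on $S$ with $d\gamma\le0$, $\gamma|_{\partial S}=0$ and $(\epsilon^i)^*\gamma=w^i\,dt$ for $|s|\gg0$; and a smooth area form on $S$, which together with $j$ gives a metric $\|\cdot\|_j$ on $S$. Let $\mathcal D$ be a collection of decorated pointed discs (the decorations chosen over the moduli spaces of pointed discs, for all $d\in\mathbb N$), and let $L$ be a constant with $\|\gamma\|_j\le L$ and $\|d\gamma\|_j\le L$ for all members of $\mathcal D$. **Suppression.** Let $\mathcal H_{S,H,J}$ be the set of smooth families $\mathbf H=\{(H_p,J_p)\}_{p\in S}$ of partial convex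 data for which $H-H_p$ and $J-J_p$ have compact support in $M\times S$. Let $I_{\mathbf H}$ be the almost complex structure on $M\times S$ with $$I_{\mathbf H}(v,w)=\bigl(J_pv-\gamma_p(w)J_pX_{H_p}+\gamma_p(jw)X_{H_p},\ jw\bigr)\quad\text{at }(m,p).$$ A function $G:M\times S\to\mathbb R$ is *$I_{\mathbf H}$-convex* if there is $C_G>0$ such that (a) for every $C\in\mathbb R$, $G$ is proper on $\{H_p(m)\le C\}$, in the sense that the set of $(m,p)\in M\times S$ with $H_p(m)\le C$ and $G(m,p)\in T$ is relatively compact in $M\times D$ for every compact $T\subset\mathbb R$; and (b) $\omega_G(u,I_{\mathbf H}u)\ge0$ for all tangent vectors $u$ at points where $G>C_G$. It is *decomposable by $g$ with bound $B$* if $G(m,p)=f(p)+g(m)$ for a smooth subharmonic $f:S\to\mathbb R$ with $\max f|_{\partial S}=B$. The function $g$ *suppresses $H$ with bound $B$* if for every $d$, every $S\in\mathcal D$ with $d+1$ marked points and every $\mathbf H\in\mathcal H_{S,H,J}$ in a ($C^\infty$-)neighbourhood of the constant family $\{(H,J)\}$ there is an $I_{\mathbf H}$-convex $G$ that is decomposable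 by $g$ with bound $B$. $H$ is *partially convex with bound $B$* if some smooth function suppresses it with bound $B$. **Lemma.** Suppose that 1. $g$ is proper on $\{H\le C\}$ for every $C\in\mathbb R$; 2. $g$ is $J$-convex; 3. there is $C_0\ge0$ with $|\mathcal L_{X_H}g|\le C_0$ and $\mathcal L_{JX_H}g\le C_0$ on $M$; 4. there is $C_1>0$ with $\max\{\|X_H\|_g,\ \|\iota_{X_H}\eta_g\|_g,\ \|\mathcal L_{X_H}dg\|_g,\ \|\mathcal L_{X_H}d^cg\|_g\}\le C_1$ on $M$. Then $g$ suppresses $H$ with bound $C_1^2L+C_0L$; in particular $H$ is partially convex with that bound. -/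

import Mathlib

open Set Filter Topology
open scoped Manifold ContDiff InnerProductSpace

noncomputable section

namespace PartialWrapping

/-! ### Differential forms on manifolds -/

section Forms

variable {E : Type*} [NormedAddCommGroup E] [NormedSpace ℝ E]
  {B : Type*} [TopologicalSpace B] (I : ModelWithCorners ℝ E B)
  {X : Type*} [TopologicalSpace X] [ChartedSpace B X]

/-- The expression of a `1`-form in the preferred chart at `x₀`. -/
def chartForm (α : ∀ x : X, TangentSpace I x →L[ℝ] ℝ) (x₀ : X) (y : E) : E →L[ℝ] ℝ :=
  (α ((extChartAt I x₀).symm y)).comp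
    (mfderivWithin 𝓘(ℝ, E) I (extChartAt I x₀).symm (range I) y)

/-- The expression of a vector field in the preferred chart at `x₀`. -/
def chartField (V : ∀ x : X, TangentSpace I x) (x₀ : X) (y : E) : E :=
  mfderiv I 𝓘(ℝ, E) (extChartAt I x₀) ((extChartAt I x₀).symm y)
    (V ((extChartAt I x₀).symm y))

/-- The expression of a field of endomorphisms of the tangent spaces in the preferred chart
at `x₀`. -/
def chartEnd (K : ∀ x : X, TangentSpace I x →L[ℝ] TangentSpace I x) (x₀ : X) (y : E) :
    E →L[ℝ] E :=
  (mfderiv I 𝓘(ℝ, E) (extChartAt I x₀) ((extChartAt I x₀).symm y)).comp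
    ((K ((extChartAt I x₀).symm y)).comp
      (mfderivWithin 𝓘(ℝ, E) I (extChartAt I x₀).symm (range I) y))

/-- The exterior derivative `dα(v, w)` at `x` of a `1`-form `α` on a subset `A` of `X` (a domain
with boundary; for instance `A = univ`), computed in the preferred chart at `x`. -/
def extD (A : Set X) (α : ∀ x : X, TangentSpace I x →L[ℝ] ℝ) (x : X)
    (v w : TangentSpace I x) : ℝ :=
  let φ := extChartAt I x
  let D := fderivWithin ℝ (chartForm I α x) (φ.symm ⁻¹' A ∩ φ.target) (φ x)
  let v' : E := mfderiv I 𝓘(ℝ, E) φ x v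
  let w' : E := mfderiv I 𝓘(ℝ, E) φ x w
  D v' w' - D w' v'

/-- The differential `dG` on the subset `A`. -/
def dfun (A : Set X) (G : X → ℝ) (x : X) : TangentSpace I x →L[ℝ] ℝ :=
  mfderivWithin I 𝓘(ℝ, ℝ) G A x

/-- The `1`-form `d^c G = dG ∘ K`. -/
def dcfun (A : Set X) (K : ∀ x : X, TangentSpace I x →L[ℝ] TangentSpace I x) (G : X → ℝ)
    (x : X) : TangentSpace I x →L[ℝ] ℝ :=
  (dfun I A G x).comp (K x)

/-- The `2`-form `ω_G = - d (dG ∘ K)`. -/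
def omega (A : Set X) (K : ∀ x : X, TangentSpace I x →L[ℝ] TangentSpace I x) (G : X → ℝ)
    (x : X) (v w : TangentSpace I x) : ℝ :=
  - extD I A (dcfun I A K G) x v w

/-- The Lie derivative `(𝓛_V α)(v)` at `x`, computed in the preferred chart at `x` by
`(𝓛_V α)(v) = (D_V α)(v) + α (D_v V)`. -/
def lieForm (V : ∀ x : X, TangentSpace I x) (α : ∀ x : X, TangentSpace I x →L[ℝ] ℝ) (x : X)
    (v : TangentSpace I x) : ℝ :=
  let φ := extChartAt I x
  let v' : E := mfderiv I 𝓘(ℝ, E) φ x v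
  fderivWithin ℝ (chartForm I α x) φ.target (φ x) (chartField I V x (φ x)) v'
    + chartForm I α x (φ x) (fderivWithin ℝ (chartField I V x) φ.target (φ x) v')

end Forms

/-! ### Exact symplectic manifolds, almost complex structures, `J`-convexity -/

section Target

variable {E : Type*} [NormedAddCommGroup E] [NormedSpace ℝ E]
  {M : Type*} [TopologicalSpace M] [ChartedSpace E M]

/-- A (not necessarily smooth) `1`-form on `M`. -/
abbrev OneForm (E : Type*) [NormedAddCommGroup E] [NormedSpace ℝ E]
    (M : Type*) [TopologicalSpace M] [ChartedSpace E M] :=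
  ∀ m : M, TangentSpace 𝓘(ℝ, E) m →L[ℝ] ℝ

/-- A (not necessarily smooth) field of endomorphisms of the tangent spaces of `M`. -/
abbrev EndField (E : Type*) [NormedAddCommGroup E] [NormedSpace ℝ E]
    (M : Type*) [TopologicalSpace M] [ChartedSpace E M] :=
  ∀ m : M, TangentSpace 𝓘(ℝ, E) m →L[ℝ] TangentSpace 𝓘(ℝ, E) m

/-- `(M, dlam)` is an exact symplectic manifold: `lam` is a smooth `1`-form and `dlam` is
nondegenerate. -/
structure IsExactSymplectic (lam : OneForm E M) : Prop where
  smooth : ∀ x₀ : M, ContDiffOn ℝ ∞ (chartForm 𝓘(ℝ, E) lam x₀) (extChartAt 𝓘(ℝ, E) x₀).target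
  nondegenerate : ∀ (m : M) (v : TangentSpace 𝓘(ℝ, E) m),
    (∀ w : TangentSpace 𝓘(ℝ, E) m, extD 𝓘(ℝ, E) univ lam m v w = 0) → v = 0

/-- `J ∈ 𝒥(M)`: a smooth almost complex structure. -/
structure IsAlmostComplex (J : EndField E M) : Prop where
  smooth : ∀ x₀ : M, ContDiffOn ℝ ∞ (chartEnd 𝓘(ℝ, E) J x₀) (extChartAt 𝓘(ℝ, E) x₀).target
  sq : ∀ (m : M) (v : TangentSpace 𝓘(ℝ, E) m), J m (J m v) = -v

/-- `ω_h(v, J v) > 0` for all non-zero `v` tangent to `M` at `m`. -/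
def IsJConvexAt (J : EndField E M) (h : M → ℝ) (m : M) : Prop :=
  ∀ v : TangentSpace 𝓘(ℝ, E) m, v ≠ 0 → 0 < omega 𝓘(ℝ, E) univ J h m v (J m v)

/-- `h` is `J`-convex. -/
def IsJConvex (J : EndField E M) (h : M → ℝ) : Prop := ∀ m, IsJConvexAt J h m

/-- The norm `‖v‖_h` of the metric `⟨v₁, v₂⟩_h = (ω_h(v₁, J v₂) + ω_h(v₂, J v₁)) / 2`. -/
def normBy (J : EndField E M) (h : M → ℝ) (m : M) (v : TangentSpace 𝓘(ℝ, E) m) : ℝ :=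
  √((omega 𝓘(ℝ, E) univ J h m v (J m v) + omega 𝓘(ℝ, E) univ J h m v (J m v)) / 2)

/-- The anti-symmetric part `η_h` of `ω_h(v₁, J v₂)`. -/
def eta (J : EndField E M) (h : M → ℝ) (m : M) (v₁ v₂ : TangentSpace 𝓘(ℝ, E) m) : ℝ :=
  (omega 𝓘(ℝ, E) univ J h m v₁ (J m v₂) - omega 𝓘(ℝ, E) univ J h m v₂ (J m v₁)) / 2

/-- The covector `α` at `m` has norm at most `C` with respect to (the norm dual to) `‖ ‖_h`. -/
def CovectorNormLE (J : EndField E M) (h : M → ℝ) (m : M) (α : TangentSpace 𝓘(ℝ, E) m → ℝ)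
    (C : ℝ) : Prop :=
  ∀ v : TangentSpace 𝓘(ℝ, E) m, |α v| ≤ C * normBy J h m v

/-- The Hamiltonian vector field of `h`, the unique vector field with `dlam(·, X) = dh`. -/
def hamField (lam : OneForm E M) (h : M → ℝ) (m : M) : TangentSpace 𝓘(ℝ, E) m :=
  Classical.epsilon fun V : TangentSpace 𝓘(ℝ, E) m =>
    ∀ v : TangentSpace 𝓘(ℝ, E) m, extD 𝓘(ℝ, E) univ lam m v V = dfun 𝓘(ℝ, E) univ h m v

/-- The Liouville vector field, the unique vector field with `dlam(Z, ·) = lam`. -/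
def liouvilleField (lam : OneForm E M) (m : M) : TangentSpace 𝓘(ℝ, E) m :=
  Classical.epsilon fun Z : TangentSpace 𝓘(ℝ, E) m =>
    ∀ v : TangentSpace 𝓘(ℝ, E) m, extD 𝓘(ℝ, E) univ lam m Z v = lam m v

/-- `(h, J)` is partial convex data. Completeness of the Liouville field and of its negative is
the existence of integral curves defined on all of `ℝ`. -/
structure IsPartialConvexData (lam : OneForm E M) (h : M → ℝ) (J : EndField E M) : Prop where
  smooth : ContMDiff 𝓘(ℝ, E) 𝓘(ℝ, ℝ) ∞ h
  almostComplex : IsAlmostComplex J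
  bddBelow : BddBelow (range h)
  convex : ∃ K : Set M, IsCompact K ∧ ∀ m ∉ K, IsJConvexAt J h m
  liouville : ∃ C : ℝ, 0 < C ∧ ∀ m, C < h m → - dcfun 𝓘(ℝ, E) univ J h m = lam m
  complete : ∀ m : M, ∃ c : ℝ → M, c 0 = m ∧
    IsMIntegralCurve (I := 𝓘(ℝ, E)) c (liouvilleField lam)

end Target

/-! ### Decorated pointed discs -/

/-- The half-strip `ℝ_{<0} × [0,1]` for the `0`-th end and `ℝ_{>0} × [0,1]` for the others. -/
def halfStrip {d : ℕ} (i : Fin (d + 1)) : Set ℂ :=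
  {z | (if i = 0 then z.re < 0 else 0 < z.re) ∧ 0 ≤ z.im ∧ z.im ≤ 1}

/-- The filter `s → -∞` on the half-strip of the `0`-th end and `s → +∞` on the others. -/
def endFilter {d : ℕ} (i : Fin (d + 1)) : Filter ℂ :=
  comap Complex.re (if i = 0 then atBot else atTop) ⊓ 𝓟 (halfStrip i)

/-- The pointed disc `S`: the closed unit disc without the marked points. -/
def pointedDisc {d : ℕ} (ζ : Fin (d + 1) → ℂ) : Set ℂ := Metric.closedBall 0 1 \ range ζ

/-- The boundary `∂S`: the unit circle without the marked points. -/
def pointedCircle {d : ℕ} (ζ : Fin (d + 1) → ℂ) : Set ℂ := Metric.sphere 0 1 \ range ζ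

/-- The value `dγ(1, i)` of the exterior derivative of a `1`-form `γ` on `S ⊆ ℂ`, that is, the
density of `dγ` relative to `dx ∧ dy`. -/
def curlWithin (γ : ℂ → ℂ →L[ℝ] ℝ) (S : Set ℂ) (z : ℂ) : ℝ :=
  fderivWithin ℝ γ S z 1 Complex.I - fderivWithin ℝ γ S z Complex.I 1

/-- A decorated pointed disc with `d + 1` marked points. Every complex structure on the closed
disc is isomorphic to the standard one, so a conformal structure on the disc with marked points is
given by the standard disc with varying marked points. `area` is the density with respect to
`dx ∧ dy` of an area form on `S`; with the complex structure it gives the metric `area • |dz|²`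
in which the `1`-form `γ` is measured. -/
structure DecoratedPointedDisc (d : ℕ) where
  /-- the marked points `exp (i θ_k)`, in counter-clockwise order -/
  angle : Fin (d + 1) → ℝ
  angle_strictMono : StrictMono angle
  angle_lt : ∀ k, angle k < angle 0 + 2 * Real.pi
  mark : Fin (d + 1) → ℂ
  mark_eq : ∀ k, mark k = Complex.exp (angle k * Complex.I)
  /-- the strip-like ends, holomorphic embeddings of the closed half-strips in `S` -/
  strip : Fin (d + 1) → ℂ → ℂ
  strip_holomorphic : ∀ i, ContDiffOn ℂ ∞ (strip i) (halfStrip i)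
  strip_deriv : ∀ i, ∀ z ∈ halfStrip i, derivWithin (strip i) (halfStrip i) z ≠ 0
  strip_embedding : ∀ i, IsEmbedding ((halfStrip i).domRestrict (strip i))
  strip_mapsTo : ∀ i, MapsTo (strip i) (halfStrip i) (pointedDisc mark)
  strip_boundary : ∀ i, ∀ z ∈ halfStrip i, z.im = 0 ∨ z.im = 1 →
    strip i z ∈ pointedCircle mark
  /-- the `i`-th end tends to the `i`-th marked point as `s → ± ∞`, and parametrizes the punctured
  neighbourhoods of that point in `S` -/
  strip_end : ∀ i, map (strip i) (endFilter i) = 𝓝[pointedDisc mark] (mark i)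
  /-- the weights -/
  weight : Fin (d + 1) → ℕ
  weight_pos : ∀ i, 0 < weight i
  weight_zero : weight 0 = ∑ i : Fin d, weight i.succ
  /-- the `1`-form -/
  γ : ℂ → ℂ →L[ℝ] ℝ
  γ_smooth : ContDiffOn ℝ ∞ γ (pointedDisc mark)
  dγ_nonpos : ∀ z ∈ pointedDisc mark, curlWithin γ (pointedDisc mark) z ≤ 0
  γ_boundary : ∀ z ∈ pointedCircle mark, γ z (Complex.I * z) = 0
  /-- `(ε^i)^* γ = w^i dt` far out on the ends -/
  γ_end : ∀ i, ∃ R : ℝ, ∀ z ∈ halfStrip i, R < |z.re| → ∀ v : ℂ,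
    γ (strip i z) (derivWithin (strip i) (halfStrip i) z * v) = weight i * v.im
  area : ℂ → ℝ
  area_smooth : ContDiffOn ℝ ∞ area (pointedDisc mark)
  area_pos : ∀ z ∈ pointedDisc mark, 0 < area z

namespace DecoratedPointedDisc

variable {d : ℕ} (S : DecoratedPointedDisc d)

/-- The surface `S` as a subset of `ℂ`. -/
def carrier : Set ℂ := pointedDisc S.mark

/-- `‖γ‖ ≤ L` and `‖dγ‖ ≤ L` on `S`, in the metric `area • |dz|²`. -/
def IsBoundedBy (L : ℝ) : Prop :=
  ∀ z ∈ S.carrier, ‖S.γ z‖ / √(S.area z) ≤ L ∧ |curlWithin S.γ S.carrier z| / S.area z ≤ L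

end DecoratedPointedDisc

/-! ### Families of partial convex data and the Gromov trick -/

section Families

variable {E : Type*} [NormedAddCommGroup E] [NormedSpace ℝ E]
  {M : Type*} [TopologicalSpace M] [ChartedSpace E M]

/-- A family `{(h_p, J_p)}` indexed by the points `p` of a subset of `ℂ` (the values at all other
points are irrelevant). -/
structure Family (E : Type*) [NormedAddCommGroup E] [NormedSpace ℝ E]
    (M : Type*) [TopologicalSpace M] [ChartedSpace E M] where
  ham : ℂ → M → ℝ
  acs : ℂ → EndField E M

/-- The constant family `{(H, J)}`. -/
def Family.const (H : M → ℝ) (J : EndField E M) : Family E M := ⟨fun _ => H, fun _ => J⟩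

/-- The expression of a family in the preferred chart of `M` at `x₀`. -/
def Family.inChart (Φ : Family E M) (x₀ : M) (y : E × ℂ) : ℝ × (E →L[ℝ] E) :=
  (Φ.ham y.2 ((extChartAt 𝓘(ℝ, E) x₀).symm y.1), chartEnd 𝓘(ℝ, E) (Φ.acs y.2) x₀ y.1)

/-- The `C^∞`-topology on families over `S`: uniform convergence on compact sets, in charts, of
all derivatives. -/
@[reducible] def familyTopology (E : Type*) [NormedAddCommGroup E] [NormedSpace ℝ E]
    (M : Type*) [TopologicalSpace M] [ChartedSpace E M] (S : Set ℂ) :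
    TopologicalSpace (Family E M) :=
  ⨅ (x₀ : M) (k : ℕ), TopologicalSpace.induced
    (fun Φ : Family E M =>
      UniformOnFun.ofFun {K : Set (E × ℂ) | IsCompact K ∧ K ⊆ (extChartAt 𝓘(ℝ, E) x₀).target ×ˢ S}
        (iteratedFDerivWithin ℝ k (Φ.inChart x₀) ((extChartAt 𝓘(ℝ, E) x₀).target ×ˢ S)))
    inferInstance

/-- `Φ ∈ 𝓗_{S,H,J}`: a smooth family over `S` of partial convex data with compact support relative
to `(H, J)`. (Such a family extends smoothly to the closed disc, by `(H, J)`.) -/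
structure IsRelativeFamily (lam : OneForm E M) (S : Set ℂ) (H : M → ℝ) (J : EndField E M)
    (Φ : Family E M) : Prop where
  data : ∀ p ∈ S, IsPartialConvexData lam (Φ.ham p) (Φ.acs p)
  smooth : ∀ x₀ : M, ContDiffOn ℝ ∞ (Φ.inChart x₀) ((extChartAt 𝓘(ℝ, E) x₀).target ×ˢ S)
  support : ∃ K : Set (M × ℂ), IsCompact K ∧ K ⊆ univ ×ˢ S ∧
    ∀ m, ∀ p ∈ S, (m, p) ∉ K → Φ.ham p m = H m ∧ Φ.acs p m = J m

/-- The almost complex structure `I_Φ` on `M × S`: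
`I_Φ (v, w) = (J_p v - γ_p(w) J_p X_{H_p} + γ_p(jw) X_{H_p}, jw)`. -/
def gromov (lam : OneForm E M) (γ : ℂ → ℂ →L[ℝ] ℝ) (Φ : Family E M) (x : M × ℂ) :
    TangentSpace (𝓘(ℝ, E).prod 𝓘(ℝ, ℂ)) x →L[ℝ] TangentSpace (𝓘(ℝ, E).prod 𝓘(ℝ, ℂ)) x :=
  let Jp : E →L[ℝ] E := Φ.acs x.2 x.1
  let XH : E := hamField lam (Φ.ham x.2) x.1
  let j : ℂ →L[ℝ] ℂ := ContinuousLinearMap.mul ℝ ℂ Complex.I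
  let fst : E × ℂ →L[ℝ] E := ContinuousLinearMap.fst ℝ E ℂ
  let snd : E × ℂ →L[ℝ] ℂ := ContinuousLinearMap.snd ℝ E ℂ
  ((Jp.comp fst - ((γ x.2).comp snd).smulRight (Jp XH)
      + ((γ x.2).comp (j.comp snd)).smulRight XH).prod (j.comp snd) : E × ℂ →L[ℝ] E × ℂ)

/-- `G : M × S → ℝ` is `I_Φ`-convex, with sublevel bound `C_G`. Properness of `G` on
`Ē_C = {(m, p) | H_p(m) ≤ C} ⊆ M × D`, for the function `G` which is defined off the marked points,
means that the preimages of compact sets are relatively compact in `M × D`. -/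
def IsGromovConvex (lam : OneForm E M) {d : ℕ} (S : DecoratedPointedDisc d) (Φ : Family E M)
    (G : M × ℂ → ℝ) : Prop :=
  ∃ C_G : ℝ, 0 < C_G ∧ ∀ C : ℝ,
    (∀ T : Set ℝ, IsCompact T →
      IsCompact (closure {x : M × ℂ | x.2 ∈ S.carrier ∧ Φ.ham x.2 x.1 ≤ C ∧ G x ∈ T})) ∧
    ∀ x : M × ℂ, x.2 ∈ S.carrier → C_G < G x →
      ∀ u : TangentSpace (𝓘(ℝ, E).prod 𝓘(ℝ, ℂ)) x,
        0 ≤ omega (𝓘(ℝ, E).prod 𝓘(ℝ, ℂ)) (univ ×ˢ S.carrier) (gromov lam S.γ Φ) G x u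
          (gromov lam S.γ Φ x u)

/-- `G : M × S → ℝ` is decomposable by `g` with bound `B`: `G = f ∘ π_S + g ∘ π_M` for a (smooth)
subharmonic function `f` on `S` whose maximum on the boundary circle is `B`. -/
def IsDecomposable {d : ℕ} (S : DecoratedPointedDisc d) (g : M → ℝ) (B : ℝ)
    (G : M × ℂ → ℝ) : Prop :=
  ∃ f : ℂ → ℝ, ContDiffOn ℝ ∞ f S.carrier ∧ (∀ z ∈ S.carrier, 0 ≤ (Δ[S.carrier] f) z) ∧
    IsGreatest (f '' pointedCircle S.mark) B ∧
    ∀ m, ∀ p ∈ S.carrier, G (m, p) = f p + g m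

/-- `g` suppresses `H` with bound `B`, with respect to the collection `𝒟` of the decorated pointed
discs chosen over the moduli spaces of pointed discs. -/
def Suppresses (lam : OneForm E M) (𝒟 : ∀ d : ℕ, Set (DecoratedPointedDisc d))
    (H : M → ℝ) (J : EndField E M) (g : M → ℝ) (B : ℝ) : Prop :=
  ∀ d : ℕ, ∀ S ∈ 𝒟 d,
    ∀ᶠ Φ in @nhds _ (familyTopology E M S.carrier) (Family.const H J),
      IsRelativeFamily lam S.carrier H J Φ →
        ∃ G : M × ℂ → ℝ, IsDecomposable S g B G ∧ IsGromovConvex lam S Φ G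

/-- `H` is partially convex with bound `B`: it has a suppressing function. -/
def IsPartiallyConvex (lam : OneForm E M) (𝒟 : ∀ d : ℕ, Set (DecoratedPointedDisc d))
    (H : M → ℝ) (J : EndField E M) (B : ℝ) : Prop :=
  ∃ g : M → ℝ, ContMDiff 𝓘(ℝ, E) 𝓘(ℝ, ℝ) ∞ g ∧ Suppresses lam 𝒟 H J g B

end Families

end PartialWrapping

end

open PartialWrapping

/-! Take `G = f + g` with `f` bounded and very subharmonic on `S`. Since `C_G` may exceed the
maximum of `G` on the compact support of the family, convexity is only needed where the family
coincides with `(H, J)`, so no smallness of the perturbation enters. Properness follows from that of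
`g`, because `f` is bounded.

For `u = (v, w)`, put `a = γ(w)` and `b = γ(jw)`. In a chart, `ω_G(u, I u)` is `‖v‖_g²`, plus terms
linear in `v` or quadratic in `(a, b)`, plus `|w|² (Δf + dg(JX) curl γ + dg(X) div γ)`. Cartan's
formula and hypothesis 4 bound the coefficients of the middle terms by multiples of `C₁`; completing
the square costs at most `24 C₁² (a² + b²)`, and `a² + b² = |w|² |γ|²`. Hypothesis 3 and `dγ ≤ 0`
control the last two terms. It therefore suffices that `Δf ≥ 24 C₁² |γ|² + C₀ |curl γ| + C₀ |div γ|`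
(`twistedForm_taming`, `neg_le_twisted`, `omega_gromov_nonneg`).

The difficulty is to keep `f` bounded, as `γ` can be unbounded in the coordinate of the disc near a
marked point. There `γ` pulls back to `w dt`, so it is closed and coclosed, with a bounded primitive
`T = w t + const`, and `Δ(T²) = 2 |γ|²`. Cutting off `T²` at each marked point and adding a
quadratic polynomial gives `f` (`exists_subharmonic`). The polynomial also forces the supremum over
`∂S` to be attained, and an additive constant gives it the prescribed value. -/

noncomputable section

namespace PartialWrapping

/-! ### Laplacians within plane domains -/

/-- The divergence of a `1`-form `γ` on `S ⊆ ℂ`: the density of `-d (γ ∘ j)` relative to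
`dx ∧ dy`. -/
def divWithin (γ : ℂ → ℂ →L[ℝ] ℝ) (S : Set ℂ) (z : ℂ) : ℝ :=
  fderivWithin ℝ γ S z 1 1 + fderivWithin ℝ γ S z Complex.I Complex.I

/-- Second derivatives of `f` enter `ω_G` only through the first derivative of the form `df`; this
translates between the two. -/
lemma laplacianWithin_eq_divWithin {S : Set ℂ} (hS : UniqueDiffOn ℝ S) {z : ℂ} (hz : z ∈ S)
    (f : ℂ → ℝ) : (Δ[S] f) z = divWithin (fderivWithin ℝ f S) S z := by
  rw [InnerProductSpace.laplacianWithin_eq_iteratedFDerivWithin_complexPlane f hS hz,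
    iteratedFDerivWithin_two_apply f hS hz, iteratedFDerivWithin_two_apply f hS hz]
  simp [divWithin]

lemma continuousOn_fderivWithin_apply_apply {S : Set ℂ} (hS : UniqueDiffOn ℝ S)
    {γ : ℂ → ℂ →L[ℝ] ℝ} (hγ : ContDiffOn ℝ ∞ γ S) (u v : ℂ) :
    ContinuousOn (fun z => fderivWithin ℝ γ S z u v) S := by
  have h := hγ.continuousOn_fderivWithin hS (by simp)
  exact (h.clm_apply continuousOn_const).clm_apply continuousOn_const

lemma continuousOn_divWithin {S : Set ℂ} (hS : UniqueDiffOn ℝ S) {γ : ℂ → ℂ →L[ℝ] ℝ}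
    (hγ : ContDiffOn ℝ ∞ γ S) : ContinuousOn (divWithin γ S) S :=
  (continuousOn_fderivWithin_apply_apply hS hγ 1 1).add
    (continuousOn_fderivWithin_apply_apply hS hγ _ _)

lemma continuousOn_curlWithin {S : Set ℂ} (hS : UniqueDiffOn ℝ S) {γ : ℂ → ℂ →L[ℝ] ℝ}
    (hγ : ContDiffOn ℝ ∞ γ S) : ContinuousOn (curlWithin γ S) S :=
  (continuousOn_fderivWithin_apply_apply hS hγ 1 _).sub
    (continuousOn_fderivWithin_apply_apply hS hγ _ 1)

lemma continuousOn_laplacianWithin {S : Set ℂ} (hS : UniqueDiffOn ℝ S) {f : ℂ → ℝ}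
    (hf : ContDiffOn ℝ ∞ f S) : ContinuousOn (Δ[S] f) S :=
  (continuousOn_divWithin hS (hf.fderivWithin hS (by simp))).congr
    fun _ hz => laplacianWithin_eq_divWithin hS hz f

/-- `Δ (T²) = 2 |dT|² + 2 T ΔT`. -/
lemma laplacianWithin_sq {S : Set ℂ} (hS : UniqueDiffOn ℝ S) {z : ℂ} (hz : z ∈ S)
    {f T : ℂ → ℝ} {γ : ℂ → ℂ →L[ℝ] ℝ} (hγ : DifferentiableWithinAt ℝ γ S z)
    (hT : ∀ᶠ y in 𝓝[S] z, HasFDerivWithinAt T (γ y) S y)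
    (hf : f =ᶠ[𝓝[S] z] fun y => T y ^ 2) :
    (Δ[S] f) z = 2 * (γ z 1 ^ 2 + γ z Complex.I ^ 2) + 2 * T z * divWithin γ S z := by
  rw [laplacianWithin_eq_divWithin hS hz, divWithin]
  have h1 : fderivWithin ℝ f S =ᶠ[𝓝[S] z] fun y => (2 * T y) • γ y := by
    filter_upwards [hT, hf.fderivWithin (𝕜 := ℝ), self_mem_nhdsWithin] with y hy hy2 hyS
    rw [hy2, (hy.pow 2).fderivWithin (hS y hyS)]
    simp
  have h2 : HasFDerivWithinAt (fun y => (2 * T y) • γ y)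
      ((2 * T z) • fderivWithin ℝ γ S z + ((2 : ℝ) • γ z).smulRight (γ z)) S z :=
    ((hT.self_of_nhdsWithin hz).const_mul 2).smul hγ.hasFDerivWithinAt
  rw [h1.fderivWithin_eq_of_mem hz, h2.fderivWithin (hS z hz)]
  simp [divWithin]
  ring

/-! ### The strip-like ends -/

variable {d : ℕ}

lemma uniqueDiffOn_pointedDisc (ζ : Fin (d + 1) → ℂ) : UniqueDiffOn ℝ (pointedDisc ζ) := by
  have h : UniqueDiffOn ℝ (Metric.closedBall (0 : ℂ) 1) :=
    uniqueDiffOn_convex (convex_closedBall 0 1) ⟨0, by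
      rw [interior_closedBall _ one_ne_zero]; simp⟩
  exact h.inter (finite_range ζ).isClosed.isOpen_compl

lemma convex_halfStrip_tail (i : Fin (d + 1)) {R : ℝ} (hR : 0 ≤ R) :
    Convex ℝ {z ∈ halfStrip i | R < |z.re|} := by
  by_cases hi : i = 0
  · have : {z ∈ halfStrip i | R < |z.re|} =
        {z : ℂ | z.re < -R} ∩ ({z | 0 ≤ z.im} ∩ {z | z.im ≤ 1}) := by
      ext z
      simp only [halfStrip, hi, if_true, mem_ofPred_eq, mem_inter_iff]
      constructor
      · rintro ⟨⟨h1, h2⟩, h3⟩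
        rw [abs_of_neg h1] at h3
        exact ⟨by linarith, h2⟩
      · rintro ⟨h1, h2⟩
        have h : z.re < 0 := by linarith
        exact ⟨⟨h, h2⟩, by rw [abs_of_neg h]; linarith⟩
    rw [this]
    exact (convex_halfSpace_re_lt _).inter ((convex_halfSpace_im_ge _).inter
      (convex_halfSpace_im_le _))
  · have : {z ∈ halfStrip i | R < |z.re|} =
        {z : ℂ | R < z.re} ∩ ({z | 0 ≤ z.im} ∩ {z | z.im ≤ 1}) := by
      ext z
      simp only [halfStrip, hi, if_false, mem_ofPred_eq, mem_inter_iff]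
      constructor
      · rintro ⟨⟨h1, h2⟩, h3⟩
        rw [abs_of_pos h1] at h3
        exact ⟨by linarith, h2⟩
      · rintro ⟨h1, h2⟩
        have h : 0 < z.re := by linarith
        exact ⟨⟨h, h2⟩, by rwa [abs_of_pos h]⟩
    rw [this]
    exact (convex_halfSpace_re_gt _).inter ((convex_halfSpace_im_ge _).inter
      (convex_halfSpace_im_le _))

lemma halfStrip_tail_zero (i : Fin (d + 1)) : {z ∈ halfStrip i | (0 : ℝ) < |z.re|} = halfStrip i := by
  refine sep_eq_self_iff_mem_true.2 fun z hz => abs_pos.2 ?_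
  have := hz.1
  split_ifs at this
  exacts [this.ne, this.ne']

lemma uniqueDiffOn_halfStrip (i : Fin (d + 1)) : UniqueDiffOn ℝ (halfStrip i) := by
  refine uniqueDiffOn_convex (halfStrip_tail_zero i ▸
    convex_halfStrip_tail i le_rfl) ?_
  have ho : IsOpen {z : ℂ | (if i = 0 then z.re < 0 else 0 < z.re) ∧ 0 < z.im ∧ z.im < 1} := by
    split_ifs
    · exact (isOpen_lt Complex.continuous_re continuous_const).inter
        ((isOpen_lt continuous_const Complex.continuous_im).inter
          (isOpen_lt Complex.continuous_im continuous_const))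
    · exact (isOpen_lt continuous_const Complex.continuous_re).inter
        ((isOpen_lt continuous_const Complex.continuous_im).inter
          (isOpen_lt Complex.continuous_im continuous_const))
  refine Nonempty.mono (interior_maximal (fun z hz => ⟨hz.1, hz.2.1.le, hz.2.2.le⟩) ho) ?_
  by_cases hi : i = 0
  · exact ⟨⟨-1, 1 / 2⟩, by simp [hi]; norm_num⟩
  · exact ⟨⟨1, 1 / 2⟩, by simp [hi]; norm_num⟩

lemma halfStrip_tail_mem_endFilter (i : Fin (d + 1)) (R : ℝ) :
    {z ∈ halfStrip i | R < |z.re|} ∈ endFilter i := by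
  unfold endFilter
  refine inter_mem (mem_inf_of_right (mem_principal_self _)) (mem_inf_of_left ?_)
  split_ifs with hi
  · refine mem_of_superset (preimage_mem_comap (Iio_mem_atBot (-R))) fun z hz => ?_
    have hz' : z.re < -R := hz
    exact lt_of_lt_of_le (by linarith) (neg_le_abs z.re)
  · refine mem_of_superset (preimage_mem_comap (Ioi_mem_atTop R)) fun z hz => ?_
    have hz' : R < z.re := hz
    exact lt_of_lt_of_le hz' (le_abs_self z.re)

lemma exists_halfStrip_tail_subset {i : Fin (d + 1)} {U : Set ℂ} (hU : U ∈ endFilter i) :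
    ∃ R : ℝ, 0 ≤ R ∧ {z ∈ halfStrip i | R < |z.re|} ⊆ U := by
  unfold endFilter at hU
  rw [mem_inf_principal, mem_comap] at hU
  obtain ⟨t, ht, htU⟩ := hU
  by_cases hi : i = 0
  · simp only [hi, if_true] at ht
    obtain ⟨a, ha⟩ := mem_atBot_sets.1 ht
    refine ⟨|a|, abs_nonneg a, fun z hz => htU (ha _ ?_) hz.1⟩
    have h1 : z.re < 0 := by simpa [hi] using hz.1.1
    have h2 := hz.2
    rw [abs_of_neg h1] at h2
    linarith [neg_abs_le a]
  · simp only [hi, if_false] at ht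
    obtain ⟨a, ha⟩ := mem_atTop_sets.1 ht
    refine ⟨|a|, abs_nonneg a, fun z hz => htU (ha _ ?_) hz.1⟩
    have h1 : 0 < z.re := by simpa [hi] using hz.1.1
    have h2 := hz.2
    rw [abs_of_pos h1] at h2
    linarith [le_abs_self a]

namespace DecoratedPointedDisc

variable (S : DecoratedPointedDisc d)

lemma uniqueDiffOn_carrier : UniqueDiffOn ℝ S.carrier := uniqueDiffOn_pointedDisc _

lemma hasDerivWithinAt_strip (i : Fin (d + 1)) {z : ℂ} (hz : z ∈ halfStrip i) :
    HasDerivWithinAt (S.strip i) (derivWithin (S.strip i) (halfStrip i) z) (halfStrip i) z :=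
  (((S.strip_holomorphic i).differentiableOn (by simp)) z hz).hasDerivWithinAt

/-- Where `γ` is a multiple of `dt`, its derivative is the imaginary part of a complex bilinear
form. -/
lemma fderivWithin_γ_end (i : Fin (d + 1)) {R : ℝ}
    (hR : ∀ z ∈ halfStrip i, R < |z.re| → ∀ v : ℂ,
      S.γ (S.strip i z) (derivWithin (S.strip i) (halfStrip i) z * v) = S.weight i * v.im)
    {z : ℂ} (hz : z ∈ halfStrip i) (hzR : R < |z.re|) :
    ∃ c : ℂ, ∀ u v : ℂ,
      fderivWithin ℝ S.γ S.carrier (S.strip i z) u v = S.weight i * (c * u * v).im := by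
  set ε := S.strip i
  set P := halfStrip i
  have hP := uniqueDiffOn_halfStrip i
  have hPC : UniqueDiffOn ℂ P := hP.mono_field
  have hne : ∀ y ∈ P, derivWithin ε P y ≠ 0 := S.strip_deriv i
  have hd : ContDiffOn ℂ ∞ (derivWithin ε P) P :=
    (S.strip_holomorphic i).derivWithin hPC (by simp)
  have hd1 := ((hd.differentiableOn (by simp)) z hz).hasDerivWithinAt
  set e := derivWithin (derivWithin ε P) P z
  have hinv : HasDerivWithinAt (fun y => (derivWithin ε P y)⁻¹) (-e / derivWithin ε P z ^ 2) P z :=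
    hd1.inv (hne z hz)
  -- With weight `n`, `γ` at `ε(y)` sends `v` to `n · Im(v / ε'(y))`. Differentiating in `y` along
  -- `u / ε'`, which `ε` carries to `u`, gives `c = -ε'' / ε'³`.
  refine ⟨-e / derivWithin ε P z ^ 2 / derivWithin ε P z, fun u v => ?_⟩
  -- two expressions for the derivative of `z ↦ γ (ε z) v`
  have hγ := ((S.γ_smooth.differentiableOn (by simp)) (ε z)
    (S.strip_mapsTo i hz)).hasFDerivWithinAt
  have h1 : HasFDerivWithinAt (fun y => S.γ (ε y) v)
      (((ContinuousLinearMap.apply ℝ ℝ v).comp (fderivWithin ℝ S.γ (pointedDisc S.mark) (ε z))).comp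
        ((ContinuousLinearMap.smulRight (1 : ℂ →L[ℂ] ℂ) (derivWithin ε P z)).restrictScalars ℝ))
      P z := by
    have h := hγ.comp z ((S.hasDerivWithinAt_strip i hz).hasFDerivWithinAt.restrictScalars ℝ)
      (S.strip_mapsTo i)
    exact (ContinuousLinearMap.apply ℝ ℝ v).hasFDerivAt.comp_hasFDerivWithinAt z h
  have h2 : HasFDerivWithinAt (fun y => (S.weight i : ℝ) * ((derivWithin ε P y)⁻¹ * v).im)
      ((S.weight i : ℝ) • (Complex.imCLM.comp ((ContinuousLinearMap.smulRight (1 : ℂ →L[ℂ] ℂ)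
        (-e / derivWithin ε P z ^ 2 * v)).restrictScalars ℝ))) P z :=
    (Complex.imCLM.hasFDerivAt.comp_hasFDerivWithinAt z
      ((hinv.mul_const v).hasFDerivWithinAt.restrictScalars ℝ)).const_mul _
  have hev : (fun y => S.γ (ε y) v) =ᶠ[𝓝[P] z]
      fun y => (S.weight i : ℝ) * ((derivWithin ε P y)⁻¹ * v).im := by
    have ho : {y : ℂ | R < |y.re|} ∈ 𝓝 z :=
      (isOpen_lt continuous_const Complex.continuous_re.abs).mem_nhds hzR
    filter_upwards [self_mem_nhdsWithin, mem_nhdsWithin_of_mem_nhds ho] with y hyP hyR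
    rw [← hR y hyP hyR, mul_inv_cancel_left₀ (hne y hyP)]
  have h3 := (hP z hz).eq (h2.congr_of_eventuallyEq hev (hev.self_of_nhdsWithin hz)) h1
  have h4 := congrArg (fun l : ℂ →L[ℝ] ℝ => l (u / derivWithin ε P z)) h3
  simp only [smul_apply, ContinuousLinearMap.comp_apply,
    ContinuousLinearMap.coe_restrictScalars', ContinuousLinearMap.smulRight_apply,
    one_apply_eq_self, smul_eq_mul, ContinuousLinearMap.apply_apply,
    div_mul_cancel₀ u (hne z hz), Complex.imCLM_apply] at h4
  change _ = fderivWithin ℝ S.γ (pointedDisc S.mark) (ε z) u v at h4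
  unfold carrier
  rw [← h4]
  congr 2
  ring

/-- Near a marked point `γ` is closed and coclosed. -/
lemma exists_ball_closed (i : Fin (d + 1)) : ∃ r > 0,
    ∀ z ∈ Metric.ball (S.mark i) r ∩ S.carrier,
      (∀ u v, fderivWithin ℝ S.γ S.carrier z u v = fderivWithin ℝ S.γ S.carrier z v u) ∧
      curlWithin S.γ S.carrier z = 0 ∧ divWithin S.γ S.carrier z = 0 := by
  obtain ⟨R, hR⟩ := S.γ_end i
  have h1 : S.strip i '' {z ∈ halfStrip i | R < |z.re|} ∈ 𝓝[S.carrier] (S.mark i) := by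
    unfold carrier
    rw [← S.strip_end i]
    exact image_mem_map (halfStrip_tail_mem_endFilter i R)
  obtain ⟨r, hr, hsub⟩ := Metric.mem_nhdsWithin_iff.1 h1
  refine ⟨r, hr, fun z hz => ?_⟩
  obtain ⟨y, hy, rfl⟩ := hsub hz
  obtain ⟨c, hc⟩ := S.fderivWithin_γ_end i hR hy.1 hy.2
  -- `Im(c u v)` is symmetric, so the curl vanishes; it is complex bilinear inside, so the trace
  -- over `1, i` vanishes by `1 + i² = 0`.
  refine ⟨fun u v => ?_, ?_, ?_⟩
  · rw [hc, hc, mul_right_comm]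
  · rw [curlWithin, hc, hc, mul_right_comm, sub_self]
  · rw [divWithin, hc, hc, mul_assoc c Complex.I, Complex.I_mul_I, ← mul_add]
    simp

end DecoratedPointedDisc

/-! ### Bounded primitives and local subharmonic functions at the marked points -/

namespace DecoratedPointedDisc

variable {d : ℕ} (S : DecoratedPointedDisc d)

lemma norm_mark (i : Fin (d + 1)) : ‖S.mark i‖ = 1 := by
  rw [S.mark_eq, Complex.norm_exp_ofReal_mul_I]

lemma exists_ball_inter_closedBall_subset (i : Fin (d + 1)) : ∃ r > 0,
    ∀ z ∈ Metric.ball (S.mark i) r, z ∈ Metric.closedBall (0 : ℂ) 1 → z ≠ S.mark i →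
      z ∈ S.carrier := by
  have hfin : (range S.mark \ {S.mark i}).Finite := (finite_range _).subset sdiff_subset
  obtain ⟨r, hr, h⟩ := Metric.mem_nhds_iff.1
    (hfin.isClosed.isOpen_compl.mem_nhds (by simp : S.mark i ∈ (range S.mark \ {S.mark i})ᶜ))
  exact ⟨r, hr, fun z hz hz1 hne => ⟨hz1, fun hm => h hz ⟨hm, hne⟩⟩⟩

/-- A point of the unit circle is extreme in the closed disc by strict convexity, and deleting an
extreme point preserves convexity. Convexity makes the Poincaré lemma available on the punctured
neighbourhood. -/
lemma convex_ball_inter_carrier (i : Fin (d + 1)) {r : ℝ}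
    (h : ∀ z ∈ Metric.ball (S.mark i) r, z ∈ Metric.closedBall (0 : ℂ) 1 → z ≠ S.mark i →
      z ∈ S.carrier) : Convex ℝ (S.carrier ∩ Metric.ball (S.mark i) r) := by
  have heq : S.carrier ∩ Metric.ball (S.mark i) r =
      (Metric.closedBall 0 1 ∩ Metric.ball (S.mark i) r) \ {S.mark i} := by
    ext z
    constructor
    · rintro ⟨⟨h1, h2⟩, h3⟩
      exact ⟨⟨h1, h3⟩, fun hz => h2 ⟨i, hz.symm⟩⟩
    · rintro ⟨⟨h1, h2⟩, h3⟩
      exact ⟨h z h2 h1 h3, h2⟩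
  rw [heq]
  rcases le_or_gt r 0 with hr | hr
  · simp [Metric.ball_eq_empty.2 hr, convex_empty]
  have hconv : Convex ℝ (Metric.closedBall (0 : ℂ) 1 ∩ Metric.ball (S.mark i) r) :=
    (convex_closedBall _ _).inter (convex_ball _ _)
  refine (hconv.mem_extremePoints_iff_convex_sdiff.1 ?_).2
  refine mem_extremePoints.2 ⟨⟨by simp [S.norm_mark], Metric.mem_ball_self hr⟩, ?_⟩
  intro a ha b hb hm
  rcases eq_or_ne a b with rfl | hne
  · rw [openSegment_same] at hm
    exact ⟨hm.symm, hm.symm⟩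
  · have := openSegment_subset_ball_of_ne ha.1 hb.1 hne hm
    rw [mem_ball_zero_iff, S.norm_mark] at this
    exact absurd this (lt_irrefl _)

/-- Near a marked point `γ` has a bounded primitive. -/
lemma exists_primitive (i : Fin (d + 1)) : ∃ r > 0, ∃ T : ℂ → ℝ, ∃ b : ℝ,
    (∀ z ∈ Metric.ball (S.mark i) r, z ∈ Metric.closedBall (0 : ℂ) 1 → z ≠ S.mark i →
      z ∈ S.carrier) ∧
    ∀ z ∈ S.carrier ∩ Metric.ball (S.mark i) r, HasFDerivWithinAt T (S.γ z) S.carrier z ∧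
      |T z| ≤ b ∧ curlWithin S.γ S.carrier z = 0 ∧ divWithin S.γ S.carrier z = 0 := by
  obtain ⟨r₁, hr₁, hsub⟩ := S.exists_ball_inter_closedBall_subset i
  obtain ⟨r₂, hr₂, hclosed⟩ := S.exists_ball_closed i
  set r := min r₁ r₂ with hr_def
  have hr : 0 < r := lt_min hr₁ hr₂
  have hconv := S.convex_ball_inter_carrier i (r := r)
    fun z hz => hsub z (Metric.ball_subset_ball (min_le_left _ _) hz)
  have hcl : ∀ z ∈ S.carrier ∩ Metric.ball (S.mark i) r, _ := fun z hz =>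
    hclosed z ⟨Metric.ball_subset_ball (min_le_right _ _) hz.2, hz.1⟩
  have hdiff : DifferentiableOn ℝ S.γ S.carrier := S.γ_smooth.differentiableOn (by simp)
  -- Poincaré lemma: `γ` is closed here and the domain is convex.
  obtain ⟨T, hT'⟩ : ∃ T : ℂ → ℝ, ∀ z ∈ S.carrier ∩ Metric.ball (S.mark i) r,
      HasFDerivWithinAt T (S.γ z) (S.carrier ∩ Metric.ball (S.mark i) r) z :=
    hconv.exists_forall_hasFDerivWithinAt_of_hasFDerivWithinAt_symmetric
      (fun z hz => (hdiff z hz.1).hasFDerivWithinAt.mono inter_subset_left)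
      (fun z hz u _ v _ => (hcl z hz).1 u v)
  have hT : ∀ z ∈ S.carrier ∩ Metric.ball (S.mark i) r,
      HasFDerivWithinAt T (S.γ z) S.carrier z := fun z hz =>
    (hasFDerivWithinAt_inter (Metric.isOpen_ball.mem_nhds hz.2)).1 (hT' z hz)
  -- `T` differs from `w t` by a constant on the end
  obtain ⟨R₁, hR₁⟩ := S.γ_end i
  have hpre : S.strip i ⁻¹' (S.carrier ∩ Metric.ball (S.mark i) r) ∈ endFilter i := by
    rw [← mem_map, S.strip_end i]
    exact inter_mem self_mem_nhdsWithin
      (mem_nhdsWithin_of_mem_nhds (Metric.ball_mem_nhds _ hr))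
  obtain ⟨R₂, hR₂, hR₂sub⟩ := exists_halfStrip_tail_subset hpre
  set R := max R₁ R₂
  set P := {z ∈ halfStrip i | R < |z.re|}
  have hP : Convex ℝ P := convex_halfStrip_tail i (hR₂.trans (le_max_right _ _))
  have hPsub : ∀ z ∈ P, S.strip i z ∈ S.carrier ∩ Metric.ball (S.mark i) r := fun z hz =>
    hR₂sub ⟨hz.1, (le_max_right _ _).trans_lt hz.2⟩
  have hder : ∀ z ∈ P, HasFDerivWithinAt (fun y => T (S.strip i y) - S.weight i * y.im)
      (0 : ℂ →L[ℝ] ℝ) P z := by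
    intro z hz
    have h1 := (hT _ (hPsub z hz)).comp z
      (((S.hasDerivWithinAt_strip i hz.1).mono (sep_subset _ _)).hasFDerivWithinAt.restrictScalars ℝ)
      (fun y hy => (hPsub y hy).1)
    have h2 : HasFDerivWithinAt (fun y : ℂ => (S.weight i : ℝ) * y.im)
        ((S.weight i : ℝ) • Complex.imCLM) P z :=
      (Complex.imCLM.hasFDerivAt.hasFDerivWithinAt).const_mul _
    refine (h1.sub h2).congr_fderiv ?_
    ext v
    simpa [sub_eq_zero, mul_comm] using hR₁ z hz.1 ((le_max_left _ _).trans_lt hz.2) v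
  obtain ⟨k, hk⟩ : ∃ k : ℝ, ∀ z ∈ P, T (S.strip i z) - S.weight i * z.im = k := by
    rcases P.eq_empty_or_nonempty with hP0 | ⟨z₀, hz₀⟩
    · exact ⟨0, fun z hz => by simp [hP0] at hz⟩
    · refine ⟨T (S.strip i z₀) - S.weight i * z₀.im, fun z hz => ?_⟩
      have h := hP.norm_image_sub_le_of_norm_hasFDerivWithin_le (C := 0) hder (by simp) hz₀ hz
      rw [zero_mul, norm_le_zero_iff, sub_eq_zero] at h
      exact h
  have himg : S.strip i '' P ∈ 𝓝[S.carrier] (S.mark i) := by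
    unfold carrier
    rw [← S.strip_end i]
    exact image_mem_map (halfStrip_tail_mem_endFilter i R)
  obtain ⟨r₃, hr₃, hr₃sub⟩ := Metric.mem_nhdsWithin_iff.1 himg
  -- On the end `T = k + w t` with `0 ≤ t ≤ 1`, and the smaller ball lies in the image of the end.
  refine ⟨min r r₃, lt_min hr hr₃, T, |k| + S.weight i, fun z hz => hsub z
    (Metric.ball_subset_ball ((min_le_left _ _).trans (min_le_left _ _)) hz), fun z hz => ?_⟩
  have hz' : z ∈ S.carrier ∩ Metric.ball (S.mark i) r :=
    ⟨hz.1, Metric.ball_subset_ball (min_le_left _ _) hz.2⟩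
  refine ⟨hT z hz', ?_, (hcl z hz').2⟩
  obtain ⟨y, hy, rfl⟩ := hr₃sub ⟨Metric.ball_subset_ball (min_le_right _ _) hz.2, hz.1⟩
  have h1 : T (S.strip i y) = k + S.weight i * y.im := by linarith [hk y hy]
  rw [h1]
  refine (abs_add_le _ _).trans (add_le_add le_rfl ?_)
  rw [abs_mul, abs_of_nonneg hy.1.2.1, abs_of_nonneg (Nat.cast_nonneg _)]
  exact mul_le_of_le_one_right (Nat.cast_nonneg _) hy.1.2.2

/-- A bounded function on `S` which near the `i`-th marked point is subharmonic with Laplacian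
controlling `|γ|²`. -/
lemma exists_local_subharmonic (i : Fin (d + 1)) : ∃ h : ℂ → ℝ, ∃ A b r : ℝ, 0 < r ∧
    ContDiffOn ℝ ∞ h S.carrier ∧ (∀ z ∈ S.carrier, |h z| ≤ b) ∧
    (∀ z ∈ S.carrier, -A ≤ (Δ[S.carrier] h) z) ∧ 0 ≤ A ∧
    ∀ z ∈ S.carrier ∩ Metric.ball (S.mark i) r,
      S.γ z 1 ^ 2 + S.γ z Complex.I ^ 2 ≤ (Δ[S.carrier] h) z ∧
      curlWithin S.γ S.carrier z = 0 ∧ divWithin S.γ S.carrier z = 0 := by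
  obtain ⟨r, hr, T, b, hsub, hT⟩ := S.exists_primitive i
  have hS := S.uniqueDiffOn_carrier
  let χ : ContDiffBump (S.mark i) := ⟨r / 3, r / 2, by positivity, by linarith⟩
  have hTsm : ContDiffOn ℝ ∞ T (S.carrier ∩ Metric.ball (S.mark i) r) := by
    have hS' := hS.inter (Metric.isOpen_ball (x := S.mark i) (ε := r))
    refine (contDiffOn_infty_iff_fderivWithin hS').2
      ⟨fun z hz => ((hT z hz).1.mono inter_subset_left).differentiableWithinAt, ?_⟩
    exact (S.γ_smooth.mono inter_subset_left).congr fun z hz =>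
      ((hT z hz).1.mono inter_subset_left).fderivWithin (hS' z hz)
  -- `T` is bounded even if `dT = γ` is not, and `Δ(T²) = 2 |γ|²` since `γ` is coclosed; the cutoff
  -- makes this a function on all of `S`.
  set h : ℂ → ℝ := fun z => χ z * T z ^ 2
  have hzero : ∀ z, r / 2 < dist z (S.mark i) → h =ᶠ[𝓝 z] fun _ => 0 := by
    intro z hz
    filter_upwards [(isOpen_lt continuous_const (continuous_id.dist continuous_const)).mem_nhds hz]
      with y hy
    have : χ y = 0 := χ.zero_of_le_dist (le_of_lt hy)
    simp [h, this]
  have hsm : ContDiffOn ℝ ∞ h S.carrier := by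
    intro z hz
    rcases lt_or_ge (dist z (S.mark i)) r with hd | hd
    · have h1 : ContDiffWithinAt ℝ ∞ T S.carrier z :=
        (contDiffWithinAt_inter (Metric.isOpen_ball.mem_nhds hd)).1 (hTsm z ⟨hz, hd⟩)
      exact χ.contDiff.contDiffWithinAt.mul (h1.pow 2)
    · exact (contDiffAt_const.congr_of_eventuallyEq
        (hzero z (by linarith))).contDiffWithinAt
  have hγd : DifferentiableOn ℝ S.γ S.carrier := S.γ_smooth.differentiableOn (by simp)
  have hnear : ∀ z ∈ S.carrier ∩ Metric.ball (S.mark i) (r / 3),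
      (Δ[S.carrier] h) z = 2 * (S.γ z 1 ^ 2 + S.γ z Complex.I ^ 2) := by
    intro z hz
    have hz' : z ∈ Metric.ball (S.mark i) r := Metric.ball_subset_ball (by linarith) hz.2
    rw [laplacianWithin_sq hS hz.1 (hγd z hz.1) (T := T), (hT z ⟨hz.1, hz'⟩).2.2.2, mul_zero,
      add_zero]
    · filter_upwards [self_mem_nhdsWithin,
        mem_nhdsWithin_of_mem_nhds (Metric.isOpen_ball.mem_nhds hz')] with y hy1 hy2
      exact (hT y ⟨hy1, hy2⟩).1
    · filter_upwards [mem_nhdsWithin_of_mem_nhds (Metric.isOpen_ball.mem_nhds hz.2)] with y hy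
      have : χ y = 1 := χ.one_of_mem_closedBall (Metric.ball_subset_closedBall hy)
      simp [h, this]
  -- The cutoff can spoil subharmonicity only on this annulus, which is compact and avoids the
  -- marked points, so the loss is a finite constant.
  have hK : IsCompact (Metric.closedBall (0 : ℂ) 1 ∩
      (Metric.closedBall (S.mark i) (r / 2) \ Metric.ball (S.mark i) (r / 3))) :=
    (isCompact_closedBall _ _).inter_right
      (Metric.isClosed_closedBall.sdiff Metric.isOpen_ball)
  have hKsub : Metric.closedBall (0 : ℂ) 1 ∩
      (Metric.closedBall (S.mark i) (r / 2) \ Metric.ball (S.mark i) (r / 3)) ⊆ S.carrier := by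
    rintro z ⟨h1, h2, h3⟩
    refine hsub z (Metric.closedBall_subset_ball (by linarith) h2) h1 ?_
    rintro rfl
    exact h3 (Metric.mem_ball_self (by positivity))
  obtain ⟨A, hA⟩ := (hK.image_of_continuousOn
    ((continuousOn_laplacianWithin hS hsm).mono hKsub)).bddBelow
  refine ⟨h, |A|, b ^ 2, r / 3, by positivity, hsm, fun z hz => ?_, fun z hz => ?_, abs_nonneg A,
    fun z hz => ?_⟩
  · rcases lt_or_ge (dist z (S.mark i)) r with hd | hd
    · have h1 := (hT z ⟨hz, hd⟩).2.1
      rw [abs_mul, abs_of_nonneg χ.nonneg, abs_pow]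
      calc χ z * |T z| ^ 2 ≤ 1 * b ^ 2 := by gcongr; exact χ.le_one
        _ = b ^ 2 := one_mul _
    · rw [(hzero z (by linarith)).self_of_nhds]
      simpa using sq_nonneg b
  · rcases lt_or_ge (dist z (S.mark i)) (r / 3) with hd | hd
    · rw [hnear z ⟨hz, hd⟩]
      have := abs_nonneg A
      nlinarith [sq_nonneg (S.γ z 1), sq_nonneg (S.γ z Complex.I)]
    rcases le_or_gt (dist z (S.mark i)) (r / 2) with hd' | hd'
    · exact (neg_abs_le A).trans (hA ⟨z, ⟨hz.1, hd', not_lt.2 hd⟩, rfl⟩)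
    · have h0 : (Δ[S.carrier] h) z = 0 := by
        have := (InnerProductSpace.laplacianWithin_congr_nhdsWithin
          ((hzero z hd').filter_mono nhdsWithin_le_nhds) hS).self_of_nhdsWithin hz
        rw [this, laplacianWithin_eq_divWithin hS hz]
        simp [divWithin]
      rw [h0]
      exact neg_nonpos.2 (abs_nonneg A)
  · have h1 := hT z ⟨hz.1, Metric.ball_subset_ball (by linarith) hz.2⟩
    refine ⟨?_, h1.2.2⟩
    rw [hnear z hz]
    nlinarith [sq_nonneg (S.γ z 1), sq_nonneg (S.γ z Complex.I)]

end DecoratedPointedDisc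

/-! ### The global subharmonic function -/

lemma two_le_infty : (2 : ℕ∞ω) ≤ ∞ := ENat.LEInfty.out

lemma laplacianWithin_sum {ι : Type*} {S : Set ℂ} (hS : UniqueDiffOn ℝ S) {z : ℂ} (hz : z ∈ S)
    (s : Finset ι) {h : ι → ℂ → ℝ} (hh : ∀ i ∈ s, ContDiffOn ℝ ∞ (h i) S) :
    (Δ[S] (∑ i ∈ s, h i)) z = ∑ i ∈ s, (Δ[S] (h i)) z := by
  classical
  induction s using Finset.induction_on with
  | empty =>
    rw [laplacianWithin_eq_divWithin hS hz]
    simp [divWithin]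
  | insert a s ha ih =>
    have h1 := (hh a (Finset.mem_insert_self a s)).of_le two_le_infty
    have h2 : ContDiffOn ℝ 2 (∑ i ∈ s, h i) S := by
      rw [show ∑ i ∈ s, h i = fun z => ∑ i ∈ s, h i z by ext; simp]
      exact ContDiffOn.sum fun i hi =>
        (hh i (Finset.mem_insert_of_mem hi)).of_le two_le_infty
    rw [Finset.sum_insert ha, Finset.sum_insert ha,
      (h1 z hz).laplacianWithin_add (h2 z hz) hS hz,
      ih fun i hi => hh i (Finset.mem_insert_of_mem hi)]

/-- The function `a |z|² - n |z - q|²`. -/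
def quadraticWeight (a n : ℝ) (q z : ℂ) : ℝ :=
  a * (z.re ^ 2 + z.im ^ 2) - n * ((z.re - q.re) ^ 2 + (z.im - q.im) ^ 2)

lemma contDiff_quadraticWeight (a n : ℝ) (q : ℂ) : ContDiff ℝ ∞ (quadraticWeight a n q) := by
  have h1 : ContDiff ℝ ∞ Complex.re := Complex.reCLM.contDiff
  have h2 : ContDiff ℝ ∞ Complex.im := Complex.imCLM.contDiff
  unfold quadraticWeight
  fun_prop

lemma laplacianWithin_quadraticWeight {S : Set ℂ} (hS : UniqueDiffOn ℝ S) {z : ℂ} (hz : z ∈ S)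
    (a n : ℝ) (q : ℂ) : (Δ[S] (quadraticWeight a n q)) z = 4 * (a - n) := by
  have h1 : ∀ y : ℂ, HasFDerivAt (quadraticWeight a n q)
      ((2 * (a * y.re - n * (y.re - q.re))) • Complex.reCLM +
        (2 * (a * y.im - n * (y.im - q.im))) • Complex.imCLM) y := by
    intro y
    have hr : HasFDerivAt Complex.re Complex.reCLM y := Complex.reCLM.hasFDerivAt
    have hi : HasFDerivAt Complex.im Complex.imCLM y := Complex.imCLM.hasFDerivAt
    refine ((((hr.pow 2).add (hi.pow 2)).const_mul a).sub
      (((((hr.sub_const q.re).pow 2).add ((hi.sub_const q.im).pow 2))).const_mul n)).congr_fderiv ?_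
    ext v
    simp
    ring
  have h2 : HasFDerivAt (fun y : ℂ => (2 * (a * y.re - n * (y.re - q.re))) • Complex.reCLM +
        (2 * (a * y.im - n * (y.im - q.im))) • Complex.imCLM)
      (((2 * (a - n)) • Complex.reCLM).smulRight Complex.reCLM +
        ((2 * (a - n)) • Complex.imCLM).smulRight Complex.imCLM) z := by
    have hr : HasFDerivAt Complex.re Complex.reCLM z := Complex.reCLM.hasFDerivAt
    have hi : HasFDerivAt Complex.im Complex.imCLM z := Complex.imCLM.hasFDerivAt
    refine (((((hr.const_mul a).sub ((hr.sub_const q.re).const_mul n)).const_mul 2).smul_const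
      Complex.reCLM).add ((((hi.const_mul a).sub
      ((hi.sub_const q.im).const_mul n)).const_mul 2).smul_const Complex.imCLM)).congr_fderiv ?_
    ext u v
    simp
    ring
  have h3 : fderivWithin ℝ (quadraticWeight a n q) S =ᶠ[𝓝[S] z] fun y : ℂ =>
      (2 * (a * y.re - n * (y.re - q.re))) • Complex.reCLM +
        (2 * (a * y.im - n * (y.im - q.im))) • Complex.imCLM := by
    filter_upwards [self_mem_nhdsWithin] with y hy
    exact (h1 y).hasFDerivWithinAt.fderivWithin (hS y hy)
  rw [laplacianWithin_eq_divWithin hS hz, divWithin, h3.fderivWithin_eq_of_mem hz,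
    h2.hasFDerivWithinAt.fderivWithin (hS z hz)]
  simp
  ring

namespace DecoratedPointedDisc

variable {d : ℕ} (S : DecoratedPointedDisc d)

/-- A bounded function on `S` whose Laplacian controls `|γ|²` near the marked points, where `γ` is
closed and coclosed. -/
lemma exists_end_subharmonic : ∃ h : ℂ → ℝ, ∃ A b : ℝ, ∃ U : Set ℂ, IsOpen U ∧
    range S.mark ⊆ U ∧ ContDiffOn ℝ ∞ h S.carrier ∧ (∀ z ∈ S.carrier, |h z| ≤ b) ∧
    ∀ z ∈ S.carrier ∩ U, S.γ z 1 ^ 2 + S.γ z Complex.I ^ 2 - A ≤ (Δ[S.carrier] h) z ∧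
      curlWithin S.γ S.carrier z = 0 ∧ divWithin S.γ S.carrier z = 0 := by
  choose h A b r hr hsm hb hA hA0 hball using S.exists_local_subharmonic
  have hS := S.uniqueDiffOn_carrier
  refine ⟨∑ i, h i, ∑ i, A i, ∑ i, b i, ⋃ i, Metric.ball (S.mark i) (r i),
    isOpen_iUnion fun i => Metric.isOpen_ball, ?_, ?_, fun z hz => ?_, fun z hz => ?_⟩
  · rintro _ ⟨i, rfl⟩
    exact mem_iUnion.2 ⟨i, Metric.mem_ball_self (hr i)⟩
  · rw [show ∑ i, h i = fun z => ∑ i, h i z by ext; simp]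
    exact ContDiffOn.sum fun i _ => hsm i
  · rw [Finset.sum_apply]
    exact (Finset.abs_sum_le_sum_abs _ _).trans (Finset.sum_le_sum fun i _ => hb i z hz)
  · obtain ⟨k, hk⟩ := mem_iUnion.1 hz.2
    obtain ⟨h1, h2⟩ := hball k z ⟨hz.1, hk⟩
    refine ⟨?_, h2⟩
    -- After adding `A i` every summand is nonnegative, so the summand of the nearby marked point is
    -- a lower bound for the sum.
    rw [laplacianWithin_sum hS hz.1 _ fun i _ => hsm i, sub_le_iff_le_add, ← Finset.sum_add_distrib]
    calc _ ≤ (Δ[S.carrier] (h k)) z := h1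
      _ ≤ (Δ[S.carrier] (h k)) z + A k := le_add_of_nonneg_right (hA0 k)
      _ ≤ _ := Finset.single_le_sum (f := fun i => (Δ[S.carrier] (h i)) z + A i)
        (fun i _ => by linarith [hA i z hz.1]) (Finset.mem_univ k)

lemma exists_mem_pointedCircle : ∃ q, q ∈ pointedCircle S.mark := by
  have hinf : (Metric.sphere (0 : ℂ) 1).Infinite := by
    refine (isPreconnected_sphere ?_ 0 1).infinite_of_nontrivial ⟨1, by simp, -1, by simp, ?_⟩
    · rw [Complex.rank_real_complex]; norm_num
    · norm_num
  exact (hinf.sdiff (finite_range S.mark)).nonempty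

lemma pointedCircle_subset_carrier : pointedCircle S.mark ⊆ S.carrier :=
  fun _ hz => ⟨Metric.sphere_subset_closedBall hz.1, hz.2⟩

/-- There is a bounded subharmonic function on `S` with prescribed (attained) maximum on the
boundary, whose Laplacian dominates a given multiple of `|γ|² + |dγ| + |d^*γ|`. -/
lemma exists_subharmonic {N : ℝ} (hN : 0 ≤ N) (C B : ℝ) : ∃ f : ℂ → ℝ, ∃ b : ℝ,
    ContDiffOn ℝ ∞ f S.carrier ∧ (∀ z ∈ S.carrier, |f z| ≤ b) ∧
    IsGreatest (f '' pointedCircle S.mark) B ∧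
    ∀ z ∈ S.carrier, N * (S.γ z 1 ^ 2 + S.γ z Complex.I ^ 2) +
      C * |curlWithin S.γ S.carrier z| + C * |divWithin S.γ S.carrier z| ≤
        (Δ[S.carrier] f) z := by
  obtain ⟨h, A, b, U, hUo, hU, hsm, hb, hUh⟩ := S.exists_end_subharmonic
  have hS := S.uniqueDiffOn_carrier
  -- the Laplacian away from the marked points
  have hK : IsCompact (Metric.closedBall (0 : ℂ) 1 \ U) := (isCompact_closedBall _ _).diff hUo
  have hKsub : Metric.closedBall (0 : ℂ) 1 \ U ⊆ S.carrier :=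
    fun z hz => ⟨hz.1, fun hm => hz.2 (hU hm)⟩
  have hγc : ∀ v, ContinuousOn (fun z => S.γ z v) S.carrier :=
    fun v => S.γ_smooth.continuousOn.clm_apply continuousOn_const
  have hcont : ContinuousOn (fun z => N * (S.γ z 1 ^ 2 + S.γ z Complex.I ^ 2) +
      C * |curlWithin S.γ S.carrier z| + C * |divWithin S.γ S.carrier z| -
        N * (Δ[S.carrier] h) z) S.carrier :=
    (((continuousOn_const.mul (((hγc 1).pow 2).add ((hγc _).pow 2))).add
      (continuousOn_const.mul (continuousOn_curlWithin hS S.γ_smooth).abs)).add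
      (continuousOn_const.mul (continuousOn_divWithin hS S.γ_smooth).abs)).sub
      (continuousOn_const.mul (continuousOn_laplacianWithin hS hsm))
  obtain ⟨A₁, hA₁⟩ := (hK.image_of_continuousOn (hcont.mono hKsub)).bddAbove
  -- a boundary point at which the maximum is nearly attained
  obtain ⟨q, hq⟩ := S.exists_mem_pointedCircle
  obtain ⟨s, hs, hsq⟩ : ∃ s > 0, ∀ i, ∀ z ∈ Metric.ball (S.mark i) s, s ≤ dist z q := by
    obtain ⟨s, hs, hsub⟩ := Metric.mem_nhds_iff.1
      ((finite_range S.mark).isClosed.isOpen_compl.mem_nhds hq.2)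
    refine ⟨s / 2, by positivity, fun i z hz => ?_⟩
    by_contra! hlt
    refine hsub (?_ : S.mark i ∈ Metric.ball q s) ⟨i, rfl⟩
    rw [Metric.mem_ball, dist_comm] at hz
    exact Metric.mem_ball.2 (by linarith [dist_triangle (S.mark i) z q])
  -- `N h` varies by at most `2 N b`, and points near the marks are at distance at least `s` from
  -- `q`: the penalty `n |z - q|²` keeps the values there below the value at `q`.
  set n : ℝ := 2 * (N * b) / s ^ 2
  -- The quadratic weight has Laplacian `4 (a - n)`: the first entry of the maximum serves the
  -- compact part, the second the neighbourhoods of the marks.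
  set a : ℝ := n + max (A₁ / 4) (N * A / 4) with ha
  set f₀ : ℂ → ℝ := N • h + quadraticWeight a n q with hf₀
  have hNh : ContDiffOn ℝ ∞ (N • h) S.carrier := hsm.const_smul N
  have hqw := (contDiff_quadraticWeight a n q).contDiffOn (s := S.carrier)
  have hf₀sm : ContDiffOn ℝ ∞ f₀ S.carrier := hNh.add hqw
  -- As `|z| = 1` here, `a` raises the Laplacian without affecting where the boundary maximum lies.
  have hcirc : ∀ z ∈ pointedCircle S.mark, f₀ z = N * h z + a - n * dist z q ^ 2 := by
    intro z hz
    have h1 : z.re ^ 2 + z.im ^ 2 = 1 := by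
      have := Complex.sq_norm z
      rw [mem_sphere_zero_iff_norm.1 hz.1, Complex.normSq_apply] at this
      linarith
    have h2 : (z.re - q.re) ^ 2 + (z.im - q.im) ^ 2 = dist z q ^ 2 := by
      rw [dist_eq_norm, Complex.sq_norm, Complex.normSq_apply, Complex.sub_re, Complex.sub_im]
      ring
    simp only [hf₀, Pi.add_apply, Pi.smul_apply, smul_eq_mul, quadraticWeight, h1, h2]
    ring
  have hKc : IsCompact (Metric.sphere (0 : ℂ) 1 \ ⋃ i, Metric.ball (S.mark i) s) :=
    (isCompact_sphere _ _).diff (isOpen_iUnion fun i => Metric.isOpen_ball)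
  have hKcsub : Metric.sphere (0 : ℂ) 1 \ (⋃ i, Metric.ball (S.mark i) s) ⊆
      pointedCircle S.mark := by
    rintro z ⟨hz1, hz2⟩
    refine ⟨hz1, ?_⟩
    rintro ⟨i, rfl⟩
    exact hz2 (mem_iUnion.2 ⟨i, Metric.mem_ball_self hs⟩)
  have hqK : q ∈ Metric.sphere (0 : ℂ) 1 \ ⋃ i, Metric.ball (S.mark i) s := by
    refine ⟨hq.1, fun hm => ?_⟩
    obtain ⟨i, hi⟩ := mem_iUnion.1 hm
    have := hsq i q hi
    rw [dist_self] at this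
    linarith
  obtain ⟨z₀, hz₀, hmax⟩ := hKc.exists_isMaxOn ⟨q, hqK⟩
    (hf₀sm.continuousOn.mono (hKcsub.trans S.pointedCircle_subset_carrier))
  have hmax' : ∀ z ∈ pointedCircle S.mark, f₀ z ≤ f₀ z₀ := by
    intro z hz
    by_cases hzK : z ∈ ⋃ i, Metric.ball (S.mark i) s
    · refine le_trans ?_ (hmax hqK)
      obtain ⟨i, hi⟩ := mem_iUnion.1 hzK
      have hb0 : 0 ≤ b := (abs_nonneg _).trans (hb q (S.pointedCircle_subset_carrier hq))
      have hn : 0 ≤ n := by positivity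
      have h1 : n * s ^ 2 ≤ n * dist z q ^ 2 := by
        have := hsq i z hi
        gcongr
      have h2 : n * s ^ 2 = 2 * (N * b) := div_mul_cancel₀ _ (by positivity)
      have h3 := mul_le_mul_of_nonneg_left
        (abs_le.1 (hb z (S.pointedCircle_subset_carrier hz))).2 hN
      have h4 := mul_le_mul_of_nonneg_left
        (abs_le.1 (hb q (S.pointedCircle_subset_carrier hq))).1 hN
      rw [hcirc z hz, hcirc q hq, dist_self]
      linarith
    · exact hmax ⟨hz.1, hzK⟩
  obtain ⟨c, hc⟩ := ((isCompact_closedBall (0 : ℂ) 1).image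
    (contDiff_quadraticWeight a n q).continuous.abs).bddAbove
  -- The shift gives the boundary maximum the value `B` and leaves the Laplacian alone.
  set k := B - f₀ z₀
  refine ⟨f₀ + fun _ => k, N * b + c + |k|, hf₀sm.add contDiffOn_const, fun z hz => ?_,
    ⟨⟨z₀, hKcsub hz₀, by simp [k]⟩, ?_⟩, fun z hz => ?_⟩
  · refine (abs_add_le _ _).trans (add_le_add ((abs_add_le _ _).trans (add_le_add ?_ ?_)) le_rfl)
    · rw [Pi.smul_apply, smul_eq_mul, abs_mul, abs_of_nonneg hN]
      exact mul_le_mul_of_nonneg_left (hb z hz) hN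
    · exact hc ⟨z, hz.1, rfl⟩
  · rintro _ ⟨z, hz, rfl⟩
    have := hmax' z hz
    simp only [Pi.add_apply, k]
    linarith
  · have h2 : (2 : ℕ∞ω) ≤ ∞ := two_le_infty
    have hlap : (Δ[S.carrier] (f₀ + fun _ => k)) z =
        N * (Δ[S.carrier] h) z + 4 * (a - n) := by
      rw [((hf₀sm.of_le h2) z hz).laplacianWithin_add contDiffWithinAt_const hS hz,
        ((hNh.of_le h2) z hz).laplacianWithin_add ((hqw.of_le h2) z hz) hS hz,
        InnerProductSpace.laplacianWithin_smul N ((hsm.of_le h2) z hz) hS hz,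
        laplacianWithin_quadraticWeight hS hz, laplacianWithin_eq_divWithin hS hz (fun _ => k)]
      simp [divWithin]
    have ha' : a - n = max (A₁ / 4) (N * A / 4) := by rw [ha]; ring
    rw [hlap, ha']
    by_cases hzU : z ∈ U
    · obtain ⟨h1, h2, h3⟩ := hUh z ⟨hz, hzU⟩
      rw [h2, h3, abs_zero, mul_zero]
      have := mul_le_mul_of_nonneg_left h1 hN
      linarith [le_max_right (A₁ / 4) (N * A / 4)]
    · have := hA₁ ⟨z, ⟨hz.1, hzU⟩, rfl⟩
      simp only at this
      linarith [le_max_left (A₁ / 4) (N * A / 4)]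

end DecoratedPointedDisc

/-! ### Differential forms and their derivatives in charts -/

section Charts

variable {E : Type*} [NormedAddCommGroup E] [NormedSpace ℝ E]
  {M : Type*} [TopologicalSpace M] [ChartedSpace E M] [IsManifold 𝓘(ℝ, E) ∞ M]

/-- The derivative of the inverse of the preferred chart at `x₀`. -/
def dSymm (x₀ : M) (y : E) : E →L[ℝ] E :=
  mfderivWithin 𝓘(ℝ, E) 𝓘(ℝ, E) (extChartAt 𝓘(ℝ, E) x₀).symm (range 𝓘(ℝ, E)) y

/-- The derivative of the preferred chart at `x₀`. -/
def dChart (x₀ : M) (m : M) : E →L[ℝ] E :=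
  mfderiv 𝓘(ℝ, E) 𝓘(ℝ, E) (extChartAt 𝓘(ℝ, E) x₀) m

omit [IsManifold 𝓘(ℝ, E) ∞ M] in
lemma chartForm_apply (α : OneForm E M) (x₀ : M) (y v : E) :
    chartForm 𝓘(ℝ, E) α x₀ y v = α ((extChartAt 𝓘(ℝ, E) x₀).symm y) (dSymm x₀ y v) := rfl

lemma dSymm_dChart {x₀ : M} {y : E} (hy : y ∈ (extChartAt 𝓘(ℝ, E) x₀).target) (v : E) :
    dSymm x₀ y (dChart x₀ ((extChartAt 𝓘(ℝ, E) x₀).symm y) v) = v :=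
  congrArg (fun l : E →L[ℝ] E => l v)
    (mfderivWithin_extChartAt_symm_comp_mfderiv_extChartAt (I := 𝓘(ℝ, E)) hy)

lemma dChart_dSymm {x₀ : M} {y : E} (hy : y ∈ (extChartAt 𝓘(ℝ, E) x₀).target) (v : E) :
    dChart x₀ ((extChartAt 𝓘(ℝ, E) x₀).symm y) (dSymm x₀ y v) = v :=
  congrArg (fun l : E →L[ℝ] E => l v)
    (mfderiv_extChartAt_comp_mfderivWithin_extChartAt_symm (I := 𝓘(ℝ, E)) hy)

lemma dChart_self (m : M) (v : E) : dChart m m v = v :=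
  congrArg (fun l : E →L[ℝ] E => l v) (mfderiv_extChartAt_self (I := 𝓘(ℝ, E)) (x := m))

lemma dSymm_self (m : M) (v : E) : dSymm m (extChartAt 𝓘(ℝ, E) m m) v = v :=
  congrArg (fun l : E →L[ℝ] E => l v)
    (mfderivWithin_range_extChartAt_symm (I := 𝓘(ℝ, E)) (x := m))

lemma hasMFDerivAt_chart_symm {x₀ : M} {y : E} (hy : y ∈ (extChartAt 𝓘(ℝ, E) x₀).target) :
    HasMFDerivAt 𝓘(ℝ, E) 𝓘(ℝ, E) (extChartAt 𝓘(ℝ, E) x₀).symm y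
      (dSymm x₀ y : E →L[ℝ] E) := by
  have h := (mdifferentiableWithinAt_extChartAt_symm (I := 𝓘(ℝ, E)) hy).hasMFDerivWithinAt
  unfold dSymm
  simp only [modelWithCornersSelf_coe, range_id] at h ⊢
  exact hasMFDerivWithinAt_univ.1 h

lemma hasMFDerivAt_chart {x₀ m : M} (hm : m ∈ (extChartAt 𝓘(ℝ, E) x₀).source) :
    HasMFDerivAt 𝓘(ℝ, E) 𝓘(ℝ, E) (extChartAt 𝓘(ℝ, E) x₀) m (dChart x₀ m : E →L[ℝ] E) :=
  (mdifferentiableAt_extChartAt (by rwa [extChartAt_source] at hm)).hasMFDerivAt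

/-- The change of coordinates between preferred charts. -/
def chartChange (x₀ x₁ : M) (y : E) : E :=
  extChartAt 𝓘(ℝ, E) x₁ ((extChartAt 𝓘(ℝ, E) x₀).symm y)

lemma contDiffAt_chartChange {x₀ x₁ : M} {y : E} (hy : y ∈ (extChartAt 𝓘(ℝ, E) x₀).target)
    (hy₁ : (extChartAt 𝓘(ℝ, E) x₀).symm y ∈ (extChartAt 𝓘(ℝ, E) x₁).source) :
    ContDiffAt ℝ ∞ (chartChange x₀ x₁) y := by
  have h1 : ContMDiffAt 𝓘(ℝ, E) 𝓘(ℝ, E) ∞ (extChartAt 𝓘(ℝ, E) x₀).symm y :=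
    (contMDiffOn_extChartAt_symm x₀).contMDiffAt ((isOpen_extChartAt_target x₀).mem_nhds hy)
  have h2 : ContMDiffAt 𝓘(ℝ, E) 𝓘(ℝ, E) ∞ (extChartAt 𝓘(ℝ, E) x₁)
      ((extChartAt 𝓘(ℝ, E) x₀).symm y) :=
    contMDiffAt_extChartAt' (by rwa [extChartAt_source] at hy₁)
  exact (h2.comp y h1).contDiffAt

lemma hasFDerivAt_chartChange {x₀ x₁ : M} {y : E} (hy : y ∈ (extChartAt 𝓘(ℝ, E) x₀).target)
    (hy₁ : (extChartAt 𝓘(ℝ, E) x₀).symm y ∈ (extChartAt 𝓘(ℝ, E) x₁).source) :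
    HasFDerivAt (chartChange x₀ x₁)
      ((dChart x₁ ((extChartAt 𝓘(ℝ, E) x₀).symm y)).comp (dSymm x₀ y)) y :=
  ((hasMFDerivAt_chart hy₁).comp y (hasMFDerivAt_chart_symm hy)).hasFDerivAt

/-- Change of coordinates for `1`-forms. -/
lemma chartForm_chartChange (α : OneForm E M) {x₀ x₁ : M} {y : E}
    (hy : y ∈ (extChartAt 𝓘(ℝ, E) x₀).target)
    (hy₁ : (extChartAt 𝓘(ℝ, E) x₀).symm y ∈ (extChartAt 𝓘(ℝ, E) x₁).source) :
    chartForm 𝓘(ℝ, E) α x₀ y =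
      (chartForm 𝓘(ℝ, E) α x₁ (chartChange x₀ x₁ y)).comp (fderiv ℝ (chartChange x₀ x₁) y) := by
  ext v
  rw [(hasFDerivAt_chartChange hy hy₁).fderiv]
  simp only [ContinuousLinearMap.comp_apply]
  rw [chartForm_apply, chartForm_apply]
  have hinv : (extChartAt 𝓘(ℝ, E) x₁).symm (chartChange x₀ x₁ y) =
      (extChartAt 𝓘(ℝ, E) x₀).symm y := (extChartAt 𝓘(ℝ, E) x₁).left_inv hy₁
  have h1 := dSymm_dChart ((extChartAt 𝓘(ℝ, E) x₁).map_source hy₁) (dSymm x₀ y v)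
  have h2 : ∀ m m' : M, m = m' → ∀ w : E, (α m : E →L[ℝ] ℝ) w = (α m' : E →L[ℝ] ℝ) w := by
    rintro m _ rfl w; rfl
  change (α _ : E →L[ℝ] ℝ) _ = (α _ : E →L[ℝ] ℝ) (dSymm x₁ (chartChange x₀ x₁ y)
    (dChart x₁ ((extChartAt 𝓘(ℝ, E) x₀).symm y) (dSymm x₀ y v)))
  rw [h2 _ _ hinv]
  unfold chartChange
  rw [(extChartAt 𝓘(ℝ, E) x₁).left_inv hy₁] at h1
  rw [h1]

lemma extD_univ_self (α : OneForm E M) (m : M) (v w : E) :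
    extD 𝓘(ℝ, E) univ α m v w =
      fderiv ℝ (chartForm 𝓘(ℝ, E) α m) (extChartAt 𝓘(ℝ, E) m m) v w -
        fderiv ℝ (chartForm 𝓘(ℝ, E) α m) (extChartAt 𝓘(ℝ, E) m m) w v := by
  have h1 := dChart_self m v
  have h2 := dChart_self m w
  unfold dChart at h1 h2
  unfold extD
  simp only [preimage_univ, univ_inter]
  rw [fderivWithin_of_isOpen (isOpen_extChartAt_target m) (mem_extChartAt_target m)]
  erw [h1, h2]

/-- The exterior derivative can be computed in any preferred chart. -/
lemma extD_univ_eq (α : OneForm E M) {x₀ m : M} (hm : m ∈ (extChartAt 𝓘(ℝ, E) x₀).source)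
    (hα : DifferentiableAt ℝ (chartForm 𝓘(ℝ, E) α x₀) (extChartAt 𝓘(ℝ, E) x₀ m)) (v w : E) :
    extD 𝓘(ℝ, E) univ α m v w =
      fderiv ℝ (chartForm 𝓘(ℝ, E) α x₀) (extChartAt 𝓘(ℝ, E) x₀ m) (dChart x₀ m v)
          (dChart x₀ m w) -
        fderiv ℝ (chartForm 𝓘(ℝ, E) α x₀) (extChartAt 𝓘(ℝ, E) x₀ m) (dChart x₀ m w)
          (dChart x₀ m v) := by
  set y := extChartAt 𝓘(ℝ, E) m m
  have hy : y ∈ (extChartAt 𝓘(ℝ, E) m).target := mem_extChartAt_target m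
  have hym : (extChartAt 𝓘(ℝ, E) m).symm y = m := extChartAt_to_inv (I := 𝓘(ℝ, E)) m
  have hy₁ : (extChartAt 𝓘(ℝ, E) m).symm y ∈ (extChartAt 𝓘(ℝ, E) x₀).source := by rwa [hym]
  set τ := chartChange (E := E) m x₀
  have hτ : ContDiffAt ℝ ∞ τ y := contDiffAt_chartChange hy hy₁
  have hτy : τ y = extChartAt 𝓘(ℝ, E) x₀ m := by
    change extChartAt 𝓘(ℝ, E) x₀ ((extChartAt 𝓘(ℝ, E) m).symm y) = _
    rw [hym]
  have hDτ : ∀ u, fderiv ℝ τ y u = dChart x₀ m u := by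
    intro u
    rw [(hasFDerivAt_chartChange hy hy₁).fderiv, ContinuousLinearMap.comp_apply, hym]
    exact congrArg _ (dSymm_self m u)
  have hev : chartForm 𝓘(ℝ, E) α m =ᶠ[𝓝 y] fun z =>
      (chartForm 𝓘(ℝ, E) α x₀ (τ z)).comp (fderiv ℝ τ z) := by
    have h1 : (extChartAt 𝓘(ℝ, E) m).symm ⁻¹' (extChartAt 𝓘(ℝ, E) x₀).source ∈ 𝓝 y :=
      (continuousAt_extChartAt_symm'' (I := 𝓘(ℝ, E)) hy).preimage_mem_nhds
        ((isOpen_extChartAt_source (I := 𝓘(ℝ, E)) x₀).mem_nhds hy₁)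
    filter_upwards [(isOpen_extChartAt_target m).mem_nhds hy, h1] with z hz hz1
    exact chartForm_chartChange α hz hz1
  rw [← hτy] at hα ⊢
  have h1 : HasFDerivAt (fun z => chartForm 𝓘(ℝ, E) α x₀ (τ z)) _ y :=
    hα.hasFDerivAt.comp y (hτ.differentiableAt (by simp)).hasFDerivAt
  have h2 : HasFDerivAt (fderiv ℝ τ) (fderiv ℝ (fderiv ℝ τ) y) y :=
    ((hτ.fderiv_right (m := 1) (by exact two_le_infty)).differentiableAt one_ne_zero).hasFDerivAt
  have h3 := h1.clm_comp h2
  -- The second derivative of the coordinate change is symmetric, so its contribution cancels on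
  -- antisymmetrizing.
  have hsym : ∀ u u', fderiv ℝ (fderiv ℝ τ) y u u' = fderiv ℝ (fderiv ℝ τ) y u' u := fun u u' =>
    (hτ.isSymmSndFDerivAt (by simpa using two_le_infty)) u u'
  rw [extD_univ_self, hev.fderiv_eq, h3.fderiv]
  simp [hDτ, hsym v w]

omit [IsManifold 𝓘(ℝ, E) ∞ M] in
lemma dfun_univ (h : M → ℝ) (m : M) :
    dfun 𝓘(ℝ, E) univ h m = mfderiv 𝓘(ℝ, E) 𝓘(ℝ, ℝ) h m := by
  unfold dfun
  rw [mfderivWithin_univ]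

lemma contDiffOn_comp_chart_symm {h : M → ℝ} (hh : ContMDiff 𝓘(ℝ, E) 𝓘(ℝ, ℝ) ∞ h) (x₀ : M) :
    ContDiffOn ℝ ∞ (fun y => h ((extChartAt 𝓘(ℝ, E) x₀).symm y))
      (extChartAt 𝓘(ℝ, E) x₀).target :=
  (hh.comp_contMDiffOn (contMDiffOn_extChartAt_symm x₀)).contDiffOn

lemma chartForm_dfun {h : M → ℝ} (hh : ContMDiff 𝓘(ℝ, E) 𝓘(ℝ, ℝ) ∞ h) {x₀ : M} {y : E}
    (hy : y ∈ (extChartAt 𝓘(ℝ, E) x₀).target) :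
    chartForm 𝓘(ℝ, E) (dfun 𝓘(ℝ, E) univ h) x₀ y =
      fderiv ℝ (fun y => h ((extChartAt 𝓘(ℝ, E) x₀).symm y)) y := by
  let A : E →L[ℝ] ℝ := mfderiv 𝓘(ℝ, E) 𝓘(ℝ, ℝ) h ((extChartAt 𝓘(ℝ, E) x₀).symm y)
  have h1 : HasFDerivAt (fun y => h ((extChartAt 𝓘(ℝ, E) x₀).symm y)) (A.comp (dSymm x₀ y)) y :=
    ((hh.mdifferentiableAt (by simp)).hasMFDerivAt.comp y
      (hasMFDerivAt_chart_symm hy)).hasFDerivAt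
  rw [h1.fderiv]
  ext v
  rw [chartForm_apply, dfun_univ]
  rfl

lemma contDiffOn_chartForm_dfun {h : M → ℝ} (hh : ContMDiff 𝓘(ℝ, E) 𝓘(ℝ, ℝ) ∞ h) (x₀ : M) :
    ContDiffOn ℝ ∞ (chartForm 𝓘(ℝ, E) (dfun 𝓘(ℝ, E) univ h) x₀)
      (extChartAt 𝓘(ℝ, E) x₀).target :=
  ((contDiffOn_comp_chart_symm hh x₀).fderiv_of_isOpen (isOpen_extChartAt_target x₀)
    (by simp)).congr fun _ hy => chartForm_dfun hh hy

/-- This is `d ∘ d = 0`; it will identify `𝓛_X dg` with `d(dg(X))`. -/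
lemma fderiv_chartForm_dfun_symm {h : M → ℝ} (hh : ContMDiff 𝓘(ℝ, E) 𝓘(ℝ, ℝ) ∞ h) {x₀ : M} {y : E}
    (hy : y ∈ (extChartAt 𝓘(ℝ, E) x₀).target) (v w : E) :
    fderiv ℝ (chartForm 𝓘(ℝ, E) (dfun 𝓘(ℝ, E) univ h) x₀) y v w =
      fderiv ℝ (chartForm 𝓘(ℝ, E) (dfun 𝓘(ℝ, E) univ h) x₀) y w v := by
  have hn := (isOpen_extChartAt_target (I := 𝓘(ℝ, E)) x₀).mem_nhds hy
  have hev : chartForm 𝓘(ℝ, E) (dfun 𝓘(ℝ, E) univ h) x₀ =ᶠ[𝓝 y]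
      fderiv ℝ (fun y => h ((extChartAt 𝓘(ℝ, E) x₀).symm y)) := by
    filter_upwards [hn] with z hz using chartForm_dfun hh hz
  rw [hev.fderiv_eq]
  exact (((contDiffOn_comp_chart_symm hh x₀).contDiffAt hn).isSymmSndFDerivAt
    (by simpa using two_le_infty)) v w

lemma chartForm_dcfun (J : EndField E M) (h : M → ℝ) {x₀ : M} {y : E}
    (hy : y ∈ (extChartAt 𝓘(ℝ, E) x₀).target) :
    chartForm 𝓘(ℝ, E) (dcfun 𝓘(ℝ, E) univ J h) x₀ y =
      (chartForm 𝓘(ℝ, E) (dfun 𝓘(ℝ, E) univ h) x₀ y).comp (chartEnd 𝓘(ℝ, E) J x₀ y) := by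
  ext v
  rw [ContinuousLinearMap.comp_apply, chartForm_apply, chartForm_apply]
  exact (congrArg (dfun 𝓘(ℝ, E) univ h ((extChartAt 𝓘(ℝ, E) x₀).symm y))
    (dSymm_dChart hy (J _ (dSymm x₀ y v)))).symm

lemma contDiffOn_chartForm_dcfun {J : EndField E M} (hJ : IsAlmostComplex J) {h : M → ℝ}
    (hh : ContMDiff 𝓘(ℝ, E) 𝓘(ℝ, ℝ) ∞ h) (x₀ : M) :
    ContDiffOn ℝ ∞ (chartForm 𝓘(ℝ, E) (dcfun 𝓘(ℝ, E) univ J h) x₀)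
      (extChartAt 𝓘(ℝ, E) x₀).target :=
  ((contDiffOn_chartForm_dfun hh x₀).clm_comp (hJ.smooth x₀)).congr
    fun _ hy => chartForm_dcfun J h hy

lemma chartForm_chartField (α : OneForm E M) (V : ∀ m : M, TangentSpace 𝓘(ℝ, E) m) {x₀ : M}
    {y : E} (hy : y ∈ (extChartAt 𝓘(ℝ, E) x₀).target) :
    chartForm 𝓘(ℝ, E) α x₀ y (chartField 𝓘(ℝ, E) V x₀ y) =
      α ((extChartAt 𝓘(ℝ, E) x₀).symm y) (V ((extChartAt 𝓘(ℝ, E) x₀).symm y)) :=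
  congrArg (α _) (dSymm_dChart hy (V _))

/-! ### Hamiltonian vector fields -/

variable [FiniteDimensional ℝ E]

lemma exists_equiv_of_injective (A : E →L[ℝ] E →L[ℝ] ℝ) (hA : ∀ v, A v = 0 → v = 0) :
    ∃ e : E ≃L[ℝ] (E →L[ℝ] ℝ), (e : E →L[ℝ] E →L[ℝ] ℝ) = A := by
  have hfr : Module.finrank ℝ E = Module.finrank ℝ (E →L[ℝ] ℝ) := by
    rw [← (LinearMap.toContinuousLinearMap : (E →ₗ[ℝ] ℝ) ≃ₗ[ℝ] E →L[ℝ] ℝ).finrank_eq]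
    exact (Subspace.dual_finrank_eq (K := ℝ) (V := E)).symm
  have hinj : Function.Injective (A : E →ₗ[ℝ] E →L[ℝ] ℝ) := by
    rw [← LinearMap.ker_eq_bot, LinearMap.ker_eq_bot']
    exact hA
  refine ⟨(LinearEquiv.ofInjectiveOfFinrankEq (A : E →ₗ[ℝ] E →L[ℝ] ℝ) hinj
    hfr).toContinuousLinearEquiv, ?_⟩
  ext v w
  rfl

/-- The bilinear form `dlam`, in the preferred chart at `x₀`, as a map `w ↦ dlam (·, w)`. -/
def sharpInv (lam : OneForm E M) (x₀ : M) (y : E) : E →L[ℝ] E →L[ℝ] ℝ :=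
  (fderiv ℝ (chartForm 𝓘(ℝ, E) lam x₀) y).flip - fderiv ℝ (chartForm 𝓘(ℝ, E) lam x₀) y

omit [FiniteDimensional ℝ E] in
-- `extD` uses a different chart at each point, while differentiating the Hamiltonian field requires
-- one fixed chart in which the point varies.
lemma extD_eq_sharpInv {lam : OneForm E M} (hlam : IsExactSymplectic lam) {x₀ m : M}
    (hm : m ∈ (extChartAt 𝓘(ℝ, E) x₀).source) (v w : E) :
    extD 𝓘(ℝ, E) univ lam m v w =
      sharpInv lam x₀ (extChartAt 𝓘(ℝ, E) x₀ m) (dChart x₀ m w) (dChart x₀ m v) := by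
  have hy := (extChartAt 𝓘(ℝ, E) x₀).map_source hm
  rw [extD_univ_eq lam hm (((hlam.smooth x₀).contDiffAt
    ((isOpen_extChartAt_target x₀).mem_nhds hy)).differentiableAt (by simp))]
  rfl

lemma exists_equiv_sharpInv {lam : OneForm E M} (hlam : IsExactSymplectic lam) {x₀ : M} {y : E}
    (hy : y ∈ (extChartAt 𝓘(ℝ, E) x₀).target) :
    ∃ e : E ≃L[ℝ] (E →L[ℝ] ℝ), (e : E →L[ℝ] E →L[ℝ] ℝ) = sharpInv lam x₀ y := by
  refine exists_equiv_of_injective _ fun v hv => ?_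
  set m := (extChartAt 𝓘(ℝ, E) x₀).symm y with hm_def
  have hm : m ∈ (extChartAt 𝓘(ℝ, E) x₀).source := (extChartAt 𝓘(ℝ, E) x₀).map_target hy
  have hy' : extChartAt 𝓘(ℝ, E) x₀ m = y := (extChartAt 𝓘(ℝ, E) x₀).right_inv hy
  have h0 : dSymm x₀ y v = 0 := by
    refine hlam.nondegenerate m (dSymm x₀ y v) fun w => ?_
    refine (extD_eq_sharpInv hlam hm _ _).trans ?_
    rw [dChart_dSymm hy, hy']
    have h1 : sharpInv lam x₀ y (dChart x₀ m w) v = - sharpInv lam x₀ y v (dChart x₀ m w) := by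
      simp [sharpInv]
    rw [h1, hv]
    simp
  rw [← dChart_dSymm hy v, h0, map_zero]

/-- The choice operator in `hamField` yields a solution only once one exists; nondegeneracy in
finite dimension supplies it. -/
lemma extD_hamField {lam : OneForm E M} (hlam : IsExactSymplectic lam) (h : M → ℝ) (m : M)
    (v : TangentSpace 𝓘(ℝ, E) m) :
    extD 𝓘(ℝ, E) univ lam m v (hamField lam h m) = dfun 𝓘(ℝ, E) univ h m v := by
  have hex : ∃ V : TangentSpace 𝓘(ℝ, E) m, ∀ v : TangentSpace 𝓘(ℝ, E) m,
      extD 𝓘(ℝ, E) univ lam m v V = dfun 𝓘(ℝ, E) univ h m v := by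
    obtain ⟨e, he⟩ := exists_equiv_sharpInv hlam (mem_extChartAt_target (I := 𝓘(ℝ, E)) m)
    let A : E →L[ℝ] ℝ := dfun 𝓘(ℝ, E) univ h m
    have key : ∀ v : E, sharpInv lam m (extChartAt 𝓘(ℝ, E) m m) (dChart m m (e.symm A))
        (dChart m m v) = A v := by
      intro v
      rw [dChart_self, dChart_self, ← he]
      exact congrArg (fun l : E →L[ℝ] ℝ => l v) (e.apply_symm_apply A)
    exact ⟨e.symm A, fun v =>
      (extD_eq_sharpInv hlam (mem_extChartAt_source m) v (e.symm A)).trans (key v)⟩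
  exact Classical.epsilon_spec hex v

/-- Hamiltonian vector fields are smooth. -/
lemma differentiableAt_chartField_hamField {lam : OneForm E M} (hlam : IsExactSymplectic lam)
    {h : M → ℝ} (hh : ContMDiff 𝓘(ℝ, E) 𝓘(ℝ, ℝ) ∞ h) {x₀ : M} {y : E}
    (hy : y ∈ (extChartAt 𝓘(ℝ, E) x₀).target) :
    DifferentiableAt ℝ (chartField 𝓘(ℝ, E) (hamField lam h) x₀) y := by
  -- In a fixed chart the field is the inverse of the symplectic form applied to `dh`, and inversion
  -- of linear maps is smooth.
  have hev : ∀ z ∈ (extChartAt 𝓘(ℝ, E) x₀).target, chartField 𝓘(ℝ, E) (hamField lam h) x₀ z =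
      (sharpInv lam x₀ z).inverse (chartForm 𝓘(ℝ, E) (dfun 𝓘(ℝ, E) univ h) x₀ z) := by
    intro z hz
    obtain ⟨e, he⟩ := exists_equiv_sharpInv hlam hz
    rw [← he, ContinuousLinearMap.inverse_equiv]
    refine (e.symm_apply_eq.2 ?_).symm
    ext v
    have h1 := (extD_eq_sharpInv hlam ((extChartAt 𝓘(ℝ, E) x₀).map_target hz)
      (dSymm x₀ z v) (hamField lam h _)).symm.trans
      (extD_hamField hlam h ((extChartAt 𝓘(ℝ, E) x₀).symm z) (dSymm x₀ z v))
    rw [dChart_dSymm hz, (extChartAt 𝓘(ℝ, E) x₀).right_inv hz, ← he] at h1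
    exact h1.symm
  have hn := (isOpen_extChartAt_target (I := 𝓘(ℝ, E)) x₀).mem_nhds hy
  have hsharp : ContDiffAt ℝ 1 (sharpInv lam x₀) y := by
    refine ContDiffOn.contDiffAt ?_ hn
    have h1 : ContDiffOn ℝ 1 (fderiv ℝ (chartForm 𝓘(ℝ, E) lam x₀))
        (extChartAt 𝓘(ℝ, E) x₀).target :=
      (hlam.smooth x₀).fderiv_of_isOpen (isOpen_extChartAt_target x₀) (by exact two_le_infty)
    have h2 : ∀ v w : E, ContDiffOn ℝ 1 (fun z => fderiv ℝ (chartForm 𝓘(ℝ, E) lam x₀) z v w)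
        (extChartAt 𝓘(ℝ, E) x₀).target :=
      fun v w => (h1.clm_apply contDiffOn_const).clm_apply contDiffOn_const
    exact contDiffOn_clm_apply.2 fun w => contDiffOn_clm_apply.2 fun v => (h2 v w).sub (h2 w v)
  obtain ⟨e, he⟩ := exists_equiv_sharpInv hlam hy
  have hinv : ContDiffAt ℝ 1 (fun z => (sharpInv lam x₀ z).inverse) y := by
    have h1 := contDiffAt_map_inverse (𝕜 := ℝ) (n := 1) e
    rw [he] at h1
    exact h1.comp y hsharp
  have hd : DifferentiableAt ℝ (fun z => (sharpInv lam x₀ z).inverse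
      (chartForm 𝓘(ℝ, E) (dfun 𝓘(ℝ, E) univ h) x₀ z)) y :=
    (hinv.differentiableAt one_ne_zero).clm_apply
      (((contDiffOn_chartForm_dfun hh x₀).contDiffAt hn).differentiableAt (by simp))
  refine hd.congr_of_eventuallyEq ?_
  filter_upwards [hn] with z hz using hev z hz

end Charts

/-! ### The linear algebra of the twisted almost complex structure -/

section Algebra

variable {E : Type*} [AddCommGroup E] [Module ℝ E]

/-- Split `Q(·, J ·)` into its symmetric part, bounded by Cauchy–Schwarz, and its antisymmetric
part, bounded by `heta`; each contributes one `C`. -/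
lemma abs_apply_le_of_taming (Q : E →ₗ[ℝ] E →ₗ[ℝ] ℝ) (J : E →ₗ[ℝ] E)
    (hpos : ∀ v, 0 ≤ Q v (J v)) {X : E} {C : ℝ} (hX : √(Q X (J X)) ≤ C)
    (heta : ∀ v, |(Q X (J v) - Q v (J X)) / 2| ≤ C * √(Q v (J v))) (v : E) :
    |Q v (J X)| ≤ 2 * C * √(Q v (J v)) ∧ |Q X (J v)| ≤ 2 * C * √(Q v (J v)) := by
  let B : LinearMap.BilinForm ℝ E := (1 / 2 : ℝ) • (Q.compl₂ J + (Q.compl₂ J).flip)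
  have hB : ∀ v w, B v w = (Q v (J w) + Q w (J v)) / 2 := by
    intro v w
    simp only [B, LinearMap.smul_apply, LinearMap.add_apply, LinearMap.compl₂_apply,
      LinearMap.flip_apply, smul_eq_mul]
    ring
  have hBv : ∀ v, B v v = Q v (J v) := fun v => by rw [hB]; ring
  have hcs := LinearMap.BilinForm.apply_sq_le_of_symm B (fun v => by rw [hBv]; exact hpos v)
    ⟨fun v w => by simp only [hB, RingHom.id_apply]; ring⟩ v X
  have hle : |B v X| ≤ C * √(Q v (J v)) := by
    rw [hBv, hBv] at hcs
    calc |B v X| ≤ √(Q v (J v) * Q X (J X)) := Real.abs_le_sqrt hcs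
      _ = √(Q X (J X)) * √(Q v (J v)) := by rw [Real.sqrt_mul (hpos v), mul_comm]
      _ ≤ C * √(Q v (J v)) := by gcongr
  have h1 : Q v (J X) = B v X - (Q X (J v) - Q v (J X)) / 2 := by rw [hB]; ring
  have h2 : Q X (J v) = B v X + (Q X (J v) - Q v (J X)) / 2 := by rw [hB]; ring
  have h3 := heta v
  rw [abs_le] at hle h3
  constructor
  · rw [h1, abs_le]
    constructor <;> linarith [hle.1, hle.2, h3.1, h3.2]
  · rw [h2, abs_le]
    constructor <;> linarith [hle.1, hle.2, h3.1, h3.2]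

/-- In the application `Q = ω_g`, `p = d(d^c g(X))`, `q = d(dg(X))`, `a = γ(w)` and `b = γ(jw)`. The
positive term `Q(v, Jv)` absorbs everything linear in `v`, leaving a multiple of `C² (a² + b²)`. -/
lemma neg_le_twisted (Q : E →ₗ[ℝ] E →ₗ[ℝ] ℝ) (J : E →ₗ[ℝ] E) (hJ : ∀ v, J (J v) = -v)
    (hQ : ∀ v w, Q v w = -Q w v) (hpos : ∀ v, 0 ≤ Q v (J v)) {X : E} {C : ℝ} (hC : 0 ≤ C)
    (hX : √(Q X (J X)) ≤ C)
    (heta : ∀ v, |(Q X (J v) - Q v (J X)) / 2| ≤ C * √(Q v (J v)))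
    (p q : E →ₗ[ℝ] ℝ) (hp : ∀ v, |p v - Q X v| ≤ C * √(Q v (J v)))
    (hq : ∀ v, |q v| ≤ C * √(Q v (J v))) (a b : ℝ) (v : E) :
    -(24 * C ^ 2 * (a ^ 2 + b ^ 2)) ≤ Q v (J v - a • J X + b • X) + p v * b + q v * a -
      p (J v - a • J X + b • X) * a + q (J v - a • J X + b • X) * b := by
  have hJn : ∀ v, Q (J v) (J (J v)) = Q v (J v) := by
    intro v
    rw [hJ, map_neg, hQ (J v) v, neg_neg]
  -- The taming bound is applied to `J v`, which has the same norm as `v`.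
  have hQX : ∀ v, |Q X v| ≤ 2 * C * √(Q v (J v)) := by
    intro v
    have h := (abs_apply_le_of_taming Q J hpos hX heta (J v)).2
    rwa [hJ, map_neg, abs_neg, map_neg, hQ (J v) v, neg_neg] at h
  have hp3 : ∀ v, |p v| ≤ 3 * C * √(Q v (J v)) := by
    intro v
    have h1 := hp v
    have h2 := hQX v
    rw [abs_le] at h1 h2 ⊢
    constructor <;> linarith [h1.1, h1.2, h2.1, h2.2]
  have hbd : ∀ {r s t : ℝ}, |s| ≤ t → -(|r| * t) ≤ r * s := by
    intro r s t hst
    refine le_trans (neg_le_neg ?_) (neg_abs_le _)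
    rw [abs_mul]
    exact mul_le_mul_of_nonneg_left hst (abs_nonneg r)
  set n := √(Q v (J v)) with hn
  have hn0 : 0 ≤ n := Real.sqrt_nonneg _
  have hnsq : Q v (J v) = n ^ 2 := (Real.sq_sqrt (hpos v)).symm
  have e1 : |-(Q v (J X))| ≤ 2 * C * n := by
    rw [abs_neg]; exact (abs_apply_le_of_taming Q J hpos hX heta v).1
  have e2 : |Q v X| ≤ 2 * C * n := by
    rw [hQ, abs_neg]; exact hQX v
  have e3 : |p v| ≤ 3 * C * n := hp3 v
  have e4 : |q v| ≤ C * n := hq v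
  have e5 : |-(p (J v))| ≤ 3 * C * n := by
    have := hp3 (J v)
    rwa [hJn, ← abs_neg] at this
  have e6 : |q (J v)| ≤ C * n := by
    have := hq (J v)
    rwa [hJn] at this
  have hC3 : 3 * C * √(Q X (J X)) ≤ 3 * C ^ 2 := by
    have := mul_le_mul_of_nonneg_left hX hC
    nlinarith
  have hC1 : C * √(Q X (J X)) ≤ C ^ 2 := by
    have := mul_le_mul_of_nonneg_left hX hC
    nlinarith
  have e7 : |p (J X)| ≤ 3 * C ^ 2 := by
    have := hp3 (J X)
    rw [hJn] at this
    exact this.trans hC3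
  have e8 : |-(p X)| ≤ 3 * C ^ 2 := by
    rw [abs_neg]
    exact (hp3 X).trans hC3
  have e9 : |-(q (J X))| ≤ C ^ 2 := by
    have := hq (J X)
    rw [hJn, ← abs_neg] at this
    exact this.trans hC1
  have e10 : |q X| ≤ C ^ 2 := (hq X).trans hC1
  have hexp : Q v (J v - a • J X + b • X) + p v * b + q v * a -
      p (J v - a • J X + b • X) * a + q (J v - a • J X + b • X) * b =
      n ^ 2 + a * -(Q v (J X)) + b * Q v X + b * p v + a * q v + a * -(p (J v)) +
        b * q (J v) + (a * a) * p (J X) + (a * b) * -(p X) + (a * b) * -(q (J X)) +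
        (b * b) * q X := by
    simp only [map_add, map_sub, map_smul, smul_eq_mul, hnsq]
    ring
  rw [hexp]
  have f1 := hbd (r := a) e1
  have f2 := hbd (r := b) e2
  have f3 := hbd (r := b) e3
  have f4 := hbd (r := a) e4
  have f5 := hbd (r := a) e5
  have f6 := hbd (r := b) e6
  have f7 := hbd (r := a * a) e7
  have f8 := hbd (r := a * b) e8
  have f9 := hbd (r := a * b) e9
  have f10 := hbd (r := b * b) e10
  rw [abs_mul] at f7 f8 f9 f10
  have ha : a ^ 2 = |a| ^ 2 := (sq_abs a).symm
  have hb : b ^ 2 = |b| ^ 2 := (sq_abs b).symm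
  rw [ha, hb]
  -- The linear terms add up to `6 C n (|a| + |b|)`; this square costs `9 C² (|a| + |b|)² ≤ 18 C²
  -- (a² + b²)`. The quadratic terms, with `4 C² |ab|` split evenly, cost at most `5 C² a² + 3 C²
  -- b²`, so 24 suffices.
  have g1 := sq_nonneg (n - 3 * C * (|a| + |b|))
  have g2 : 0 ≤ C ^ 2 * (|a| - |b|) ^ 2 := by positivity
  have g3 : 0 ≤ C ^ 2 * |a| ^ 2 := by positivity
  have g4 : 0 ≤ C ^ 2 * |b| ^ 2 := by positivity
  nlinarith

end Algebra

/-- The pair `w, iw` is the basis `1, i` rotated and scaled by `|w|`, so trace, curl and squared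
norm all scale by `|w|²`. -/
lemma bilin_trace (L : ℂ →L[ℝ] ℂ →L[ℝ] ℝ) (w : ℂ) :
    L w w + L (Complex.I * w) (Complex.I * w) =
      (w.re ^ 2 + w.im ^ 2) * (L 1 1 + L Complex.I Complex.I) := by
  have h1 : w = w.re • (1 : ℂ) + w.im • Complex.I := by
    simp [Complex.re_add_im]
  have h2 : Complex.I * w = (-w.im) • (1 : ℂ) + w.re • Complex.I := by
    apply Complex.ext <;> simp
  rw [h2, h1]
  simp only [map_add, map_smul, add_apply, smul_apply, smul_eq_mul]
  simp
  ring

lemma bilin_curl (L : ℂ →L[ℝ] ℂ →L[ℝ] ℝ) (w : ℂ) :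
    L w (Complex.I * w) - L (Complex.I * w) w =
      (w.re ^ 2 + w.im ^ 2) * (L 1 Complex.I - L Complex.I 1) := by
  have h1 : w = w.re • (1 : ℂ) + w.im • Complex.I := by
    simp [Complex.re_add_im]
  have h2 : Complex.I * w = (-w.im) • (1 : ℂ) + w.re • Complex.I := by
    apply Complex.ext <;> simp
  rw [h2, h1]
  simp only [map_add, map_smul, add_apply, smul_apply, smul_eq_mul]
  simp
  ring

lemma sq_add_sq_apply (l : ℂ →L[ℝ] ℝ) (w : ℂ) :
    l w ^ 2 + l (Complex.I * w) ^ 2 =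
      (w.re ^ 2 + w.im ^ 2) * (l 1 ^ 2 + l Complex.I ^ 2) := by
  have h1 : w = w.re • (1 : ℂ) + w.im • Complex.I := by
    simp [Complex.re_add_im]
  have h2 : Complex.I * w = (-w.im) • (1 : ℂ) + w.re • Complex.I := by
    apply Complex.ext <;> simp
  rw [h2, h1]
  simp only [map_add, map_smul, smul_eq_mul]
  simp
  ring

/-! ### The twisted form in a chart -/

section Twisted

variable {E : Type*} [NormedAddCommGroup E] [NormedSpace ℝ E]

/-- The expression of `d^c (f + g)` for the twisted almost complex structure on `M × S`, in terms of
`θ = d^c g`, `κ = dg`, the Hamiltonian vector field `X`, and `f' = df`. -/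
def twistedForm (θ κ : E → E →L[ℝ] ℝ) (X : E → E) (γ f' : ℂ → ℂ →L[ℝ] ℝ) (x : E × ℂ) :
    E × ℂ →L[ℝ] ℝ :=
  (θ x.1).comp (ContinuousLinearMap.fst ℝ E ℂ)
    - (θ x.1 (X x.1)) • (γ x.2).comp (ContinuousLinearMap.snd ℝ E ℂ)
    + (κ x.1 (X x.1)) • (γ x.2).comp
      ((ContinuousLinearMap.mul ℝ ℂ Complex.I).comp (ContinuousLinearMap.snd ℝ E ℂ))
    + (f' x.2).comp ((ContinuousLinearMap.mul ℝ ℂ Complex.I).comp (ContinuousLinearMap.snd ℝ E ℂ))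

variable {θ κ : E → E →L[ℝ] ℝ} {X : E → E} {γ f' : ℂ → ℂ →L[ℝ] ℝ} {y : E} {z : ℂ} {U : Set E}
  {S : Set ℂ}

lemma fderivWithin_twistedForm (hθ : DifferentiableAt ℝ θ y) (hκ : DifferentiableAt ℝ κ y)
    (hX : DifferentiableAt ℝ X y) (hγ : DifferentiableWithinAt ℝ γ S z)
    (hf : DifferentiableWithinAt ℝ f' S z) (hu : UniqueDiffWithinAt ℝ (U ×ˢ S) (y, z))
    (v v' : E) (w w' : ℂ) :
    fderivWithin ℝ (twistedForm θ κ X γ f') (U ×ˢ S) (y, z) (v, w) (v', w') =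
      fderiv ℝ θ y v v' - (fderiv ℝ θ y v (X y) + θ y (fderiv ℝ X y v)) * γ z w'
        - θ y (X y) * fderivWithin ℝ γ S z w w'
        + (fderiv ℝ κ y v (X y) + κ y (fderiv ℝ X y v)) * γ z (Complex.I * w')
        + κ y (X y) * fderivWithin ℝ γ S z w (Complex.I * w')
        + fderivWithin ℝ f' S z w (Complex.I * w') := by
  have h1 : HasFDerivWithinAt (Prod.fst : E × ℂ → E) (ContinuousLinearMap.fst ℝ E ℂ) (U ×ˢ S)
      (y, z) := hasFDerivWithinAt_fst
  have h2 : HasFDerivWithinAt (Prod.snd : E × ℂ → ℂ) (ContinuousLinearMap.snd ℝ E ℂ) (U ×ˢ S)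
      (y, z) := hasFDerivWithinAt_snd
  have hmaps : MapsTo (Prod.snd : E × ℂ → ℂ) (U ×ˢ S) S := fun x hx => hx.2
  have aθ : HasFDerivWithinAt (fun x : E × ℂ => θ x.1) _ (U ×ˢ S) (y, z) :=
    HasFDerivAt.comp_hasFDerivWithinAt (y, z) (f := Prod.fst) hθ.hasFDerivAt h1
  have aκ : HasFDerivWithinAt (fun x : E × ℂ => κ x.1) _ (U ×ˢ S) (y, z) :=
    HasFDerivAt.comp_hasFDerivWithinAt (y, z) (f := Prod.fst) hκ.hasFDerivAt h1
  have aX : HasFDerivWithinAt (fun x : E × ℂ => X x.1) _ (U ×ˢ S) (y, z) :=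
    HasFDerivAt.comp_hasFDerivWithinAt (y, z) (f := Prod.fst) hX.hasFDerivAt h1
  have aγ : HasFDerivWithinAt (fun x : E × ℂ => γ x.2) _ (U ×ˢ S) (y, z) :=
    HasFDerivWithinAt.comp (y, z) (f := Prod.snd) hγ.hasFDerivWithinAt h2 hmaps
  have af : HasFDerivWithinAt (fun x : E × ℂ => f' x.2) _ (U ×ˢ S) (y, z) :=
    HasFDerivWithinAt.comp (y, z) (f := Prod.snd) hf.hasFDerivWithinAt h2 hmaps
  have hd : DifferentiableWithinAt ℝ (twistedForm θ κ X γ f') (U ×ˢ S) (y, z) := by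
    have bθ := aθ.differentiableWithinAt
    have bκ := aκ.differentiableWithinAt
    have bX := aX.differentiableWithinAt
    have bγ := aγ.differentiableWithinAt
    have bf := af.differentiableWithinAt
    have c : ∀ l : E × ℂ →L[ℝ] ℂ, DifferentiableWithinAt ℝ (fun _ : E × ℂ => l) (U ×ˢ S) (y, z) :=
      fun l => differentiableWithinAt_const l
    exact (((bθ.clm_comp (differentiableWithinAt_const _)).sub
      ((bθ.clm_apply bX).smul (bγ.clm_comp (c _)))).add
      ((bκ.clm_apply bX).smul (bγ.clm_comp (c _)))).add (bf.clm_comp (c _))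
  -- Evaluate the form on the fixed vector `(v', w')` and differentiate this scalar function in two
  -- ways; unique differentiability equates the results.
  have e1 := hd.hasFDerivWithinAt.clm_apply (hasFDerivWithinAt_const (v', w') (y, z) (U ×ˢ S))
  have e2 := ((((aθ.clm_apply (hasFDerivWithinAt_const v' (y, z) (U ×ˢ S))).sub
    ((aθ.clm_apply aX).mul (aγ.clm_apply (hasFDerivWithinAt_const w' (y, z) (U ×ˢ S))))).add
    ((aκ.clm_apply aX).mul
      (aγ.clm_apply (hasFDerivWithinAt_const (Complex.I * w') (y, z) (U ×ˢ S))))).add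
    (af.clm_apply (hasFDerivWithinAt_const (Complex.I * w') (y, z) (U ×ˢ S))))
  have e3 := congrArg (fun l : E × ℂ →L[ℝ] ℝ => l (v, w)) (hu.eq e1 e2)
  simp only [add_apply, ContinuousLinearMap.comp_apply, ContinuousLinearMap.flip_apply,
    smul_apply, smul_eq_mul, zero_apply, map_zero, zero_add, sub_apply,
    ContinuousLinearMap.coe_fst', ContinuousLinearMap.coe_snd'] at e3
  rw [e3]
  ring

/-- `- d (d^c (f + g)) (u, I u)` for the twisted almost complex structure. -/
lemma twistedForm_taming (hθ : DifferentiableAt ℝ θ y) (hκ : DifferentiableAt ℝ κ y)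
    (hX : DifferentiableAt ℝ X y) (hγ : DifferentiableWithinAt ℝ γ S z)
    (hf : DifferentiableWithinAt ℝ f' S z) (hu : UniqueDiffWithinAt ℝ (U ×ˢ S) (y, z))
    (v V : E) (w : ℂ) :
    -(fderivWithin ℝ (twistedForm θ κ X γ f') (U ×ˢ S) (y, z) (v, w) (V, Complex.I * w) -
      fderivWithin ℝ (twistedForm θ κ X γ f') (U ×ˢ S) (y, z) (V, Complex.I * w) (v, w)) =
      -(fderiv ℝ θ y v V - fderiv ℝ θ y V v) +
      (fderiv ℝ θ y v (X y) + θ y (fderiv ℝ X y v)) * γ z (Complex.I * w) +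
      (fderiv ℝ κ y v (X y) + κ y (fderiv ℝ X y v)) * γ z w -
      (fderiv ℝ θ y V (X y) + θ y (fderiv ℝ X y V)) * γ z w +
      (fderiv ℝ κ y V (X y) + κ y (fderiv ℝ X y V)) * γ z (Complex.I * w) +
      (w.re ^ 2 + w.im ^ 2) * (divWithin f' S z + θ y (X y) * curlWithin γ S z +
        κ y (X y) * divWithin γ S z) := by
  -- Because `j² = -1`, the terms containing `j` (from `f'` and `κ(X) γ`) become traces, while the
  -- term `θ(X) γ` becomes a curl.
  have hI : Complex.I * (Complex.I * w) = -w := by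
    rw [← mul_assoc, Complex.I_mul_I, neg_one_mul]
  rw [fderivWithin_twistedForm hθ hκ hX hγ hf hu, fderivWithin_twistedForm hθ hκ hX hγ hf hu, hI]
  have h1 := bilin_trace (fderivWithin ℝ f' S z) w
  have h2 := bilin_trace (fderivWithin ℝ γ S z) w
  have h3 := bilin_curl (fderivWithin ℝ γ S z) w
  simp only [map_neg]
  unfold divWithin curlWithin
  linear_combination h1 + κ y (X y) * h2 + θ y (X y) * h3

end Twisted

/-! ### Charts and differentials on `M × S` -/

section Product

variable {E : Type*} [NormedAddCommGroup E] [NormedSpace ℝ E]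
  {M : Type*} [TopologicalSpace M] [ChartedSpace E M]

lemma extChartAt_prod_complex (m : M) (p : ℂ) :
    extChartAt (𝓘(ℝ, E).prod 𝓘(ℝ, ℂ)) (m, p) =
      (extChartAt 𝓘(ℝ, E) m).prod (PartialEquiv.refl ℂ) := by
  rw [extChartAt_prod, extChartAt_model_space_eq_id]

variable [IsManifold 𝓘(ℝ, E) ∞ M]

lemma mfderivWithin_prod_chart_symm {m : M} (p : ℂ) {y : E}
    (hy : y ∈ (extChartAt 𝓘(ℝ, E) m).target) (z : ℂ) (u : E × ℂ) :
    mfderivWithin 𝓘(ℝ, E × ℂ) (𝓘(ℝ, E).prod 𝓘(ℝ, ℂ))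
      (extChartAt (𝓘(ℝ, E).prod 𝓘(ℝ, ℂ)) (m, p)).symm (range (𝓘(ℝ, E).prod 𝓘(ℝ, ℂ))) (y, z) u =
      ((dSymm m y u.1, u.2) : E × ℂ) := by
  have hr : range (𝓘(ℝ, E).prod 𝓘(ℝ, ℂ)) = univ := by
    simp
  have h1 : HasMFDerivAt 𝓘(ℝ, E × ℂ) 𝓘(ℝ, E) (Prod.fst : E × ℂ → E) (y, z)
      (ContinuousLinearMap.fst ℝ E ℂ) := hasFDerivAt_fst.hasMFDerivAt
  have h2 : HasMFDerivAt 𝓘(ℝ, E × ℂ) 𝓘(ℝ, ℂ) (Prod.snd : E × ℂ → ℂ) (y, z)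
      (ContinuousLinearMap.snd ℝ E ℂ) := hasFDerivAt_snd.hasMFDerivAt
  have h3 : HasMFDerivAt 𝓘(ℝ, E × ℂ) 𝓘(ℝ, E)
      (fun q : E × ℂ => (extChartAt 𝓘(ℝ, E) m).symm q.1) (y, z)
      ((dSymm m y).comp (ContinuousLinearMap.fst ℝ E ℂ) : E × ℂ →L[ℝ] E) :=
    HasMFDerivAt.comp (y, z) (f := Prod.fst) (hasMFDerivAt_chart_symm hy) h1
  have h4 := (h3.prodMk h2).mfderiv
  rw [hr, mfderivWithin_univ, extChartAt_prod_complex]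
  exact congrArg (fun l : E × ℂ →L[ℝ] E × ℂ => l u) h4

omit [IsManifold 𝓘(ℝ, E) ∞ M] in
lemma dfun_prod {g : M → ℝ} (hg : ContMDiff 𝓘(ℝ, E) 𝓘(ℝ, ℝ) ∞ g) {f : ℂ → ℝ} {S : Set ℂ}
    (hS : UniqueDiffOn ℝ S) (hf : DifferentiableOn ℝ f S) {G : M × ℂ → ℝ}
    (hG : ∀ m, ∀ p ∈ S, G (m, p) = f p + g m) {m : M} {p : ℂ} (hp : p ∈ S) (u : E × ℂ) :
    dfun (𝓘(ℝ, E).prod 𝓘(ℝ, ℂ)) (univ ×ˢ S) G (m, p) u =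
      dfun 𝓘(ℝ, E) univ g m u.1 + fderivWithin ℝ f S p u.2 := by
  have hu : UniqueMDiffWithinAt (𝓘(ℝ, E).prod 𝓘(ℝ, ℂ)) ((univ : Set M) ×ˢ S) (m, p) :=
    (uniqueMDiffOn_univ.prod hS.uniqueMDiffOn) _ ⟨mem_univ _, hp⟩
  have h1 : HasMFDerivWithinAt (𝓘(ℝ, E).prod 𝓘(ℝ, ℂ)) 𝓘(ℝ, ℝ) (fun x : M × ℂ => g x.1)
      (univ ×ˢ S) (m, p) _ :=
    HasMFDerivAt.comp_hasMFDerivWithinAt (m, p) (f := Prod.fst)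
      (hg.mdifferentiableAt (by simp)).hasMFDerivAt (hasMFDerivWithinAt_fst _ (m, p))
  have h2 : HasMFDerivWithinAt (𝓘(ℝ, E).prod 𝓘(ℝ, ℂ)) 𝓘(ℝ, ℝ) (fun x : M × ℂ => f x.2)
      (univ ×ˢ S) (m, p) _ :=
    HasMFDerivWithinAt.comp (m, p) (f := Prod.snd)
      (hf p hp).hasFDerivWithinAt.hasMFDerivWithinAt (hasMFDerivWithinAt_snd _ (m, p))
      (fun x hx => hx.2)
  have h3 : HasMFDerivWithinAt (𝓘(ℝ, E).prod 𝓘(ℝ, ℂ)) 𝓘(ℝ, ℝ) (fun x : M × ℂ => f x.2 + g x.1)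
      (univ ×ˢ S) (m, p) _ := ⟨h2.1.add h1.1, h2.2.add h1.2⟩
  have h4 : HasMFDerivWithinAt (𝓘(ℝ, E).prod 𝓘(ℝ, ℂ)) 𝓘(ℝ, ℝ) G (univ ×ˢ S) (m, p) _ :=
    h3.congr_of_eventuallyEq (by
      filter_upwards [self_mem_nhdsWithin] with x hx using hG x.1 x.2 hx.2) (hG m p hp)
  have h5 := congrArg (fun l : E × ℂ →L[ℝ] ℝ => l u) (h4.mfderivWithin hu)
  unfold dfun
  rw [mfderivWithin_univ, add_comm]
  exact h5

end Product

/-! ### The twisted almost complex structure in product charts -/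

section Gromov

variable {E : Type*} [NormedAddCommGroup E] [NormedSpace ℝ E]
  {M : Type*} [TopologicalSpace M] [ChartedSpace E M]

lemma gromov_apply (lam : OneForm E M) (γ : ℂ → ℂ →L[ℝ] ℝ) {Φ : Family E M} {H : M → ℝ}
    {J : EndField E M} {m : M} {p : ℂ} (hham : hamField lam (Φ.ham p) m = hamField lam H m)
    (hacs : Φ.acs p m = J m) (u : E × ℂ) :
    gromov lam γ Φ (m, p) u =
      (((J m u.1 : E) - γ p u.2 • (J m (hamField lam H m) : E) +
        γ p (Complex.I * u.2) • (hamField lam H m : E), Complex.I * u.2) : E × ℂ) := by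
  rw [← hham, ← hacs]
  rfl

/-- The field involves `dh`, so agreement of the Hamiltonians is required near `m` and not merely at
`m`. -/
lemma hamField_congr (lam : OneForm E M) {h h' : M → ℝ} {m : M} (hh : h =ᶠ[𝓝 m] h') :
    hamField lam h m = hamField lam h' m := by
  unfold hamField
  rw [dfun_univ, dfun_univ, hh.mfderiv_eq]

variable [IsManifold 𝓘(ℝ, E) ∞ M]

/-- In the product chart, `d^c (f + g)` for the twisted almost complex structure is a
`twistedForm`. -/
lemma chartForm_dcfun_gromov (lam : OneForm E M) (γ : ℂ → ℂ →L[ℝ] ℝ) {Φ : Family E M}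
    {H g : M → ℝ} {J : EndField E M} (hg : ContMDiff 𝓘(ℝ, E) 𝓘(ℝ, ℝ) ∞ g) {f : ℂ → ℝ} {S : Set ℂ}
    (hS : UniqueDiffOn ℝ S) (hf : DifferentiableOn ℝ f S) {G : M × ℂ → ℝ}
    (hG : ∀ m, ∀ p ∈ S, G (m, p) = f p + g m) {m : M} {p : ℂ} {y : E}
    (hy : y ∈ (extChartAt 𝓘(ℝ, E) m).target) {z : ℂ} (hz : z ∈ S)
    (hham : hamField lam (Φ.ham z) ((extChartAt 𝓘(ℝ, E) m).symm y) =
      hamField lam H ((extChartAt 𝓘(ℝ, E) m).symm y))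
    (hacs : Φ.acs z ((extChartAt 𝓘(ℝ, E) m).symm y) = J ((extChartAt 𝓘(ℝ, E) m).symm y)) :
    chartForm (𝓘(ℝ, E).prod 𝓘(ℝ, ℂ))
        (dcfun (𝓘(ℝ, E).prod 𝓘(ℝ, ℂ)) (univ ×ˢ S) (gromov lam γ Φ) G) (m, p) (y, z) =
      twistedForm (chartForm 𝓘(ℝ, E) (dcfun 𝓘(ℝ, E) univ J g) m)
        (chartForm 𝓘(ℝ, E) (dfun 𝓘(ℝ, E) univ g) m) (chartField 𝓘(ℝ, E) (hamField lam H) m)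
        γ (fderivWithin ℝ f S) (y, z) := by
  refine ContinuousLinearMap.ext fun u => ?_
  set m' := (extChartAt 𝓘(ℝ, E) m).symm y
  have hsymm : (extChartAt (𝓘(ℝ, E).prod 𝓘(ℝ, ℂ)) (m, p)).symm (y, z) = (m', z) := by
    rw [extChartAt_prod_complex]; rfl
  have hD := mfderivWithin_prod_chart_symm (m := m) p hy z u
  have hκX := chartForm_chartField (dfun 𝓘(ℝ, E) univ g) (hamField lam H) hy
  have hθX := chartForm_chartField (dcfun 𝓘(ℝ, E) univ J g) (hamField lam H) hy
  have hα : ∀ x x' : M × ℂ, x = x' → ∀ w : E × ℂ,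
      (dcfun (𝓘(ℝ, E).prod 𝓘(ℝ, ℂ)) (univ ×ˢ S) (gromov lam γ Φ) G x : E × ℂ →L[ℝ] ℝ) w =
      (dcfun (𝓘(ℝ, E).prod 𝓘(ℝ, ℂ)) (univ ×ˢ S) (gromov lam γ Φ) G x' : E × ℂ →L[ℝ] ℝ) w := by
    rintro x _ rfl w; rfl
  have h1 : chartForm (𝓘(ℝ, E).prod 𝓘(ℝ, ℂ))
      (dcfun (𝓘(ℝ, E).prod 𝓘(ℝ, ℂ)) (univ ×ˢ S) (gromov lam γ Φ) G) (m, p) (y, z) u =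
      dfun (𝓘(ℝ, E).prod 𝓘(ℝ, ℂ)) (univ ×ˢ S) G (m', z)
        (gromov lam γ Φ (m', z) ((dSymm m y u.1, u.2) : E × ℂ)) := by
    refine Eq.trans ?_ (hα _ _ hsymm (dSymm m y u.1, u.2))
    exact congrArg (dcfun (𝓘(ℝ, E).prod 𝓘(ℝ, ℂ)) (univ ×ˢ S) (gromov lam γ Φ) G _) hD
  have h2 := gromov_apply lam γ hham hacs ((dSymm m y u.1, u.2) : E × ℂ)
  have h3 := (congrArg (dfun (𝓘(ℝ, E).prod 𝓘(ℝ, ℂ)) (univ ×ˢ S) G (m', z)) h2).trans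
    (dfun_prod hg hS hf hG (m := m') hz _)
  rw [h1]
  refine h3.trans ?_
  let κ : E →L[ℝ] ℝ := dfun 𝓘(ℝ, E) univ g m'
  let XH : E := hamField lam H m'
  let Jm : E →L[ℝ] E := J m'
  change κ (Jm (dSymm m y u.1) - γ z u.2 • Jm XH + γ z (Complex.I * u.2) • XH) +
    fderivWithin ℝ f S z (Complex.I * u.2) = κ (Jm (dSymm m y u.1)) - _ * γ z u.2 +
      _ * γ z (Complex.I * u.2) + fderivWithin ℝ f S z (Complex.I * u.2)
  have hκX' : chartForm 𝓘(ℝ, E) (dfun 𝓘(ℝ, E) univ g) m y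
    (chartField 𝓘(ℝ, E) (hamField lam H) m y) = κ XH := hκX
  have hθX' : chartForm 𝓘(ℝ, E) (dcfun 𝓘(ℝ, E) univ J g) m y
    (chartField 𝓘(ℝ, E) (hamField lam H) m y) = κ (Jm XH) := hθX
  change _ = _ - (chartForm 𝓘(ℝ, E) (dcfun 𝓘(ℝ, E) univ J g) m y
    (chartField 𝓘(ℝ, E) (hamField lam H) m y)) * _ + (chartForm 𝓘(ℝ, E) (dfun 𝓘(ℝ, E) univ g) m y
    (chartField 𝓘(ℝ, E) (hamField lam H) m y)) * _ + _
  rw [hκX', hθX']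
  simp only [map_add, map_sub, map_smul, smul_eq_mul]
  ring

lemma extD_prod_self {S : Set ℂ} (α : ∀ x : M × ℂ, TangentSpace (𝓘(ℝ, E).prod 𝓘(ℝ, ℂ)) x →L[ℝ] ℝ)
    (m : M) (p : ℂ) (u u' : E × ℂ) :
    extD (𝓘(ℝ, E).prod 𝓘(ℝ, ℂ)) (univ ×ˢ S) α (m, p) u u' =
      fderivWithin ℝ (chartForm (𝓘(ℝ, E).prod 𝓘(ℝ, ℂ)) α (m, p))
        ((extChartAt 𝓘(ℝ, E) m).target ×ˢ S) (extChartAt 𝓘(ℝ, E) m m, p) u u' -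
      fderivWithin ℝ (chartForm (𝓘(ℝ, E).prod 𝓘(ℝ, ℂ)) α (m, p))
        ((extChartAt 𝓘(ℝ, E) m).target ×ˢ S) (extChartAt 𝓘(ℝ, E) m m, p) u' u := by
  have hset : (extChartAt (𝓘(ℝ, E).prod 𝓘(ℝ, ℂ)) (m, p)).symm ⁻¹' (univ ×ˢ S) ∩
      (extChartAt (𝓘(ℝ, E).prod 𝓘(ℝ, ℂ)) (m, p)).target =
      (extChartAt 𝓘(ℝ, E) m).target ×ˢ S := by
    rw [extChartAt_prod_complex]
    ext x
    simp [and_comm]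
  have hpt : extChartAt (𝓘(ℝ, E).prod 𝓘(ℝ, ℂ)) (m, p) (m, p) = (extChartAt 𝓘(ℝ, E) m m, p) := by
    rw [extChartAt_prod_complex]; rfl
  have hself : ∀ w : E × ℂ, (mfderiv (𝓘(ℝ, E).prod 𝓘(ℝ, ℂ)) 𝓘(ℝ, E × ℂ)
      (extChartAt (𝓘(ℝ, E).prod 𝓘(ℝ, ℂ)) (m, p)) (m, p) : E × ℂ →L[ℝ] E × ℂ) w = w := fun w =>
    congrArg (fun l : E × ℂ →L[ℝ] E × ℂ => l w)
      (mfderiv_extChartAt_self (I := 𝓘(ℝ, E).prod 𝓘(ℝ, ℂ)) (x := (m, p)))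
  unfold extD
  simp only [hset, hpt]
  have h1 := hself u
  have h2 := hself u'
  erw [h1, h2]

lemma omega_univ_self (J : EndField E M) (g : M → ℝ) (m : M) (v w : E) :
    omega 𝓘(ℝ, E) univ J g m v w =
      -(fderiv ℝ (chartForm 𝓘(ℝ, E) (dcfun 𝓘(ℝ, E) univ J g) m) (extChartAt 𝓘(ℝ, E) m m) v w -
        fderiv ℝ (chartForm 𝓘(ℝ, E) (dcfun 𝓘(ℝ, E) univ J g) m) (extChartAt 𝓘(ℝ, E) m m) w v) :=
  congrArg Neg.neg (extD_univ_self _ m v w)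

lemma lieForm_self (V : ∀ m : M, TangentSpace 𝓘(ℝ, E) m) (α : OneForm E M) (m : M) (v : E) :
    lieForm 𝓘(ℝ, E) V α m v =
      fderiv ℝ (chartForm 𝓘(ℝ, E) α m) (extChartAt 𝓘(ℝ, E) m m)
          (chartField 𝓘(ℝ, E) V m (extChartAt 𝓘(ℝ, E) m m)) v +
        chartForm 𝓘(ℝ, E) α m (extChartAt 𝓘(ℝ, E) m m)
          (fderiv ℝ (chartField 𝓘(ℝ, E) V m) (extChartAt 𝓘(ℝ, E) m m) v) := by
  have h1 := dChart_self m v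
  unfold dChart at h1
  unfold lieForm
  simp only
  rw [fderivWithin_of_isOpen (isOpen_extChartAt_target m) (mem_extChartAt_target m),
    fderivWithin_of_isOpen (isOpen_extChartAt_target m) (mem_extChartAt_target m)]
  erw [h1]

lemma chartField_self (V : ∀ m : M, TangentSpace 𝓘(ℝ, E) m) (m : M) :
    chartField 𝓘(ℝ, E) V m (extChartAt 𝓘(ℝ, E) m m) = V m := by
  have h : ∀ m' : M, m' = m → dChart (E := E) m m' (V m') = V m := by
    rintro _ rfl
    exact dChart_self _ _
  exact h _ (extChartAt_to_inv (I := 𝓘(ℝ, E)) m)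

omit [IsManifold 𝓘(ℝ, E) ∞ M] in
lemma apply_congr_point (α : OneForm E M) {m m' : M} (h : m = m') (v : E) :
    (α m : E →L[ℝ] ℝ) v = (α m' : E →L[ℝ] ℝ) v := by
  subst h; rfl

lemma chartForm_self (α : OneForm E M) (m : M) (v : E) :
    chartForm 𝓘(ℝ, E) α m (extChartAt 𝓘(ℝ, E) m m) v = α m v := by
  refine (apply_congr_point α (extChartAt_to_inv (I := 𝓘(ℝ, E)) m) _).trans ?_
  exact congrArg (α m) (dSymm_self m v)

end Gromov

/-! ### Convexity and properness of `f + g` -/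

section Suppression

variable {E : Type*} [NormedAddCommGroup E] [NormedSpace ℝ E] [FiniteDimensional ℝ E]
  {M : Type*} [TopologicalSpace M] [ChartedSpace E M] [IsManifold 𝓘(ℝ, E) ∞ M]

/-- The pointwise convexity estimate where the family is locally constant. -/
lemma omega_gromov_nonneg {lam : OneForm E M} (hlam : IsExactSymplectic lam)
    {H g : M → ℝ} (hH : ContMDiff 𝓘(ℝ, E) 𝓘(ℝ, ℝ) ∞ H) (hg : ContMDiff 𝓘(ℝ, E) 𝓘(ℝ, ℝ) ∞ g)
    {J : EndField E M} (hJ : IsAlmostComplex J) {d : ℕ} (S : DecoratedPointedDisc d)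
    {C₀ C₁ : ℝ} (hC₁ : 0 ≤ C₁) {m : M} (hconvex : IsJConvexAt J g m)
    (hlie : |dfun 𝓘(ℝ, E) univ g m (hamField lam H m)| ≤ C₀ ∧
      dfun 𝓘(ℝ, E) univ g m (J m (hamField lam H m)) ≤ C₀)
    (hX : normBy J g m (hamField lam H m) ≤ C₁)
    (heta : CovectorNormLE J g m (eta J g m (hamField lam H m)) C₁)
    (hdg : CovectorNormLE J g m (lieForm 𝓘(ℝ, E) (hamField lam H) (dfun 𝓘(ℝ, E) univ g) m) C₁)
    (hdcg : CovectorNormLE J g m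
      (lieForm 𝓘(ℝ, E) (hamField lam H) (dcfun 𝓘(ℝ, E) univ J g) m) C₁)
    {f : ℂ → ℝ} (hf : ContDiffOn ℝ ∞ f S.carrier) {p : ℂ} (hp : p ∈ S.carrier)
    (hlap : 24 * C₁ ^ 2 * (S.γ p 1 ^ 2 + S.γ p Complex.I ^ 2) +
      C₀ * |curlWithin S.γ S.carrier p| + C₀ * |divWithin S.γ S.carrier p| ≤ (Δ[S.carrier] f) p)
    {G : M × ℂ → ℝ} (hG : ∀ m, ∀ p ∈ S.carrier, G (m, p) = f p + g m) {Φ : Family E M}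
    (hΦ : ∀ᶠ x : M × ℂ in 𝓝 (m, p), x.2 ∈ S.carrier →
      hamField lam (Φ.ham x.2) x.1 = hamField lam H x.1 ∧ Φ.acs x.2 x.1 = J x.1)
    (u : E × ℂ) :
    0 ≤ omega (𝓘(ℝ, E).prod 𝓘(ℝ, ℂ)) (univ ×ˢ S.carrier) (gromov lam S.γ Φ) G (m, p) u
      (gromov lam S.γ Φ (m, p) u) := by
  have hS := S.uniqueDiffOn_carrier
  set φ := extChartAt 𝓘(ℝ, E) m with hφ
  set y := φ m with hy_def
  have hy : y ∈ φ.target := mem_extChartAt_target m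
  have hn : φ.target ∈ 𝓝 y := (isOpen_extChartAt_target m).mem_nhds hy
  have hym : φ.symm y = m := extChartAt_to_inv (I := 𝓘(ℝ, E)) m
  set θ := chartForm 𝓘(ℝ, E) (dcfun 𝓘(ℝ, E) univ J g) m with hθ_def
  set κ := chartForm 𝓘(ℝ, E) (dfun 𝓘(ℝ, E) univ g) m with hκ_def
  set X := chartField 𝓘(ℝ, E) (hamField lam H) m with hX_def
  have hθ : DifferentiableAt ℝ θ y :=
    ((contDiffOn_chartForm_dcfun hJ hg m).contDiffAt hn).differentiableAt (by simp)
  have hκ : DifferentiableAt ℝ κ y :=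
    ((contDiffOn_chartForm_dfun hg m).contDiffAt hn).differentiableAt (by simp)
  have hXd : DifferentiableAt ℝ X y := differentiableAt_chartField_hamField hlam hH hy
  have hγ : DifferentiableWithinAt ℝ S.γ S.carrier p :=
    (S.γ_smooth.differentiableOn (by simp)) p hp
  have hf' : DifferentiableWithinAt ℝ (fderivWithin ℝ f S.carrier) S.carrier p :=
    ((hf.fderivWithin (m := ∞) hS (by simp)).differentiableOn (by simp)) p hp
  have hu : UniqueDiffWithinAt ℝ (φ.target ×ˢ S.carrier) (y, p) :=
    ((isOpen_extChartAt_target m).uniqueDiffWithinAt hy).prod (hS p hp)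
  have hev : chartForm (𝓘(ℝ, E).prod 𝓘(ℝ, ℂ))
      (dcfun (𝓘(ℝ, E).prod 𝓘(ℝ, ℂ)) (univ ×ˢ S.carrier) (gromov lam S.γ Φ) G) (m, p)
      =ᶠ[𝓝[φ.target ×ˢ S.carrier] (y, p)]
      twistedForm θ κ X S.γ (fderivWithin ℝ f S.carrier) := by
    have hcont : Tendsto (fun q : E × ℂ => (φ.symm q.1, q.2)) (𝓝 (y, p)) (𝓝 (m, p)) := by
      have h1 : ContinuousAt φ.symm y := continuousAt_extChartAt_symm (I := 𝓘(ℝ, E)) m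
      have h2 : ContinuousAt (fun q : E × ℂ => (φ.symm q.1, q.2)) (y, p) :=
        (ContinuousAt.comp (x := (y, p)) (f := Prod.fst) h1 continuousAt_fst).prodMk continuousAt_snd
      have h3 := h2.tendsto
      simp only [hym] at h3
      exact h3
    filter_upwards [self_mem_nhdsWithin, mem_nhdsWithin_of_mem_nhds (hcont.eventually hΦ)]
      with q hq hqΦ
    obtain ⟨h1, h2⟩ := hqΦ hq.2
    exact chartForm_dcfun_gromov lam S.γ hg hS (hf.differentiableOn (by simp)) hG hq.1 hq.2 h1 h2
  obtain ⟨hham, hacs⟩ := hΦ.self_of_nhds hp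
  let XH : E := hamField lam H m
  let Jm : E →L[ℝ] E := J m
  obtain ⟨v, w⟩ := u
  have hgr := gromov_apply lam S.γ hham hacs (v, w)
  have hgoal : omega (𝓘(ℝ, E).prod 𝓘(ℝ, ℂ)) (univ ×ˢ S.carrier) (gromov lam S.γ Φ) G (m, p) (v, w)
      (gromov lam S.γ Φ (m, p) (v, w)) = _ :=
    (congrArg (omega (𝓘(ℝ, E).prod 𝓘(ℝ, ℂ)) (univ ×ˢ S.carrier) (gromov lam S.γ Φ) G (m, p) (v, w))
      hgr).trans (congrArg Neg.neg (extD_prod_self _ m p _ _))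
  rw [hgoal, hev.fderivWithin_eq_of_mem ⟨hy, hp⟩]
  change 0 ≤ -(fderivWithin ℝ (twistedForm θ κ X S.γ (fderivWithin ℝ f S.carrier))
      (φ.target ×ˢ S.carrier) (y, p) (v, w)
        (Jm v - S.γ p w • Jm XH + S.γ p (Complex.I * w) • XH, Complex.I * w) -
    fderivWithin ℝ (twistedForm θ κ X S.γ (fderivWithin ℝ f S.carrier))
      (φ.target ×ˢ S.carrier) (y, p)
        (Jm v - S.γ p w • Jm XH + S.γ p (Complex.I * w) • XH, Complex.I * w) (v, w))
  rw [twistedForm_taming hθ hκ hXd hγ hf' hu]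
  have hXy : X y = XH := chartField_self (hamField lam H) m
  have hθX : θ y XH ≤ C₀ := (chartForm_self (dcfun 𝓘(ℝ, E) univ J g) m XH).trans_le hlie.2
  have hκX : |κ y XH| ≤ C₀ :=
    (congrArg abs (chartForm_self (dfun 𝓘(ℝ, E) univ g) m XH)).trans_le hlie.1
  rw [hXy]
  -- `Q` is `ω_g` at `m`; below, `P` and `R` are the differentials of the functions `d^c g(X)` and
  -- `dg(X)`.
  let Q : E →ₗ[ℝ] E →ₗ[ℝ] ℝ := LinearMap.mk₂ ℝ
    (fun v w => -(fderiv ℝ θ y v w - fderiv ℝ θ y w v))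
    (fun a b c => by simp only [map_add, add_apply]; ring)
    (fun r a b => by simp only [map_smul, smul_apply, smul_eq_mul]; ring)
    (fun a b c => by simp only [map_add, add_apply]; ring)
    (fun r a b => by simp only [map_smul, smul_apply, smul_eq_mul]; ring)
  have hQ : ∀ v w : E, omega 𝓘(ℝ, E) univ J g m v w = Q v w := omega_univ_self J g m
  let P : E →ₗ[ℝ] ℝ :=
    ((fderiv ℝ θ y).flip XH + (θ y).comp (fderiv ℝ X y) : E →L[ℝ] ℝ).toLinearMap
  let R : E →ₗ[ℝ] ℝ :=
    ((fderiv ℝ κ y).flip XH + (κ y).comp (fderiv ℝ X y) : E →L[ℝ] ℝ).toLinearMap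
  have hnorm : ∀ v : E, normBy J g m v = √(Q v (Jm v)) := by
    intro v
    have h1 : omega 𝓘(ℝ, E) univ J g m v (J m v) = Q v (Jm v) := hQ v (Jm v)
    unfold normBy
    rw [h1]
    congr 1
    ring
  have hpos : ∀ v : E, 0 ≤ Q v (Jm v) := by
    intro v
    rcases eq_or_ne v 0 with rfl | hv
    · simp
    · exact ((hconvex v hv).trans_eq (hQ v (Jm v))).le
  have hetaQ : ∀ v : E, |(Q XH (Jm v) - Q v (Jm XH)) / 2| ≤ C₁ * √(Q v (Jm v)) := by
    intro v
    have h1 := heta v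
    rw [hnorm] at h1
    have h2 : eta J g m (hamField lam H m) v = (Q XH (Jm v) - Q v (Jm XH)) / 2 :=
      congrArg₂ (fun a b : ℝ => (a - b) / 2) (hQ XH (Jm v)) (hQ v (Jm XH))
    rwa [h2] at h1
  have hP : ∀ v : E, |P v - Q XH v| ≤ C₁ * √(Q v (Jm v)) := by
    intro v
    have h1 := hdcg v
    rw [hnorm] at h1
    -- Cartan's formula `𝓛_X θ = d(θ(X)) + ι_X dθ` with `dθ = -ω_g`.
    have h2 : lieForm 𝓘(ℝ, E) (hamField lam H) (dcfun 𝓘(ℝ, E) univ J g) m v = P v - Q XH v := by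
      refine (lieForm_self (hamField lam H) _ m v).trans ?_
      change fderiv ℝ θ y (X y) v + θ y (fderiv ℝ X y v) =
        fderiv ℝ θ y v XH + θ y (fderiv ℝ X y v) - -(fderiv ℝ θ y XH v - fderiv ℝ θ y v XH)
      rw [hXy]
      ring
    rwa [h2] at h1
  have hR : ∀ v : E, |R v| ≤ C₁ * √(Q v (Jm v)) := by
    intro v
    have h1 := hdg v
    rw [hnorm] at h1
    have h2 : lieForm 𝓘(ℝ, E) (hamField lam H) (dfun 𝓘(ℝ, E) univ g) m v = R v := by
      refine (lieForm_self (hamField lam H) _ m v).trans ?_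
      change fderiv ℝ κ y (X y) v + κ y (fderiv ℝ X y v) =
        fderiv ℝ κ y v XH + κ y (fderiv ℝ X y v)
      rw [hXy, fderiv_chartForm_dfun_symm hg hy]
    rwa [h2] at h1
  have hXn : √(Q XH (Jm XH)) ≤ C₁ := (hnorm XH).symm.trans_le hX
  have hmain := neg_le_twisted Q (Jm : E →ₗ[ℝ] E) (fun v => hJ.sq m v)
    (fun v w => by simp only [Q, LinearMap.mk₂_apply]; ring) hpos hC₁ hXn hetaQ P R hP hR
    (S.γ p w) (S.γ p (Complex.I * w)) v
  have hsq := sq_add_sq_apply (S.γ p) w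
  rw [hsq] at hmain
  have hlap' : 24 * C₁ ^ 2 * (S.γ p 1 ^ 2 + S.γ p Complex.I ^ 2) ≤
      divWithin (fderivWithin ℝ f S.carrier) S.carrier p +
        θ y XH * curlWithin S.γ S.carrier p + κ y XH * divWithin S.γ S.carrier p := by
    rw [laplacianWithin_eq_divWithin hS hp] at hlap
    -- The sign of `dγ` is why an upper bound on `dg(JX)` is enough; `div γ` has no sign, so `dg(X)`
    -- needs a two-sided bound.
    have hcurl : curlWithin S.γ S.carrier p ≤ 0 := S.dγ_nonpos p hp
    have h1 := mul_le_mul_of_nonpos_right hθX hcurl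
    have h2 : |κ y XH * divWithin S.γ S.carrier p| ≤ C₀ * |divWithin S.γ S.carrier p| := by
      rw [abs_mul]
      exact mul_le_mul_of_nonneg_right hκX (abs_nonneg _)
    rw [abs_of_nonpos hcurl] at hlap
    linarith [neg_abs_le (κ y XH * divWithin S.γ S.carrier p)]
  have hfin := mul_le_mul_of_nonneg_left hlap' (by positivity : 0 ≤ w.re ^ 2 + w.im ^ 2)
  change -_ ≤ -(fderiv ℝ θ y v (Jm v - S.γ p w • Jm XH + S.γ p (Complex.I * w) • XH) -
      fderiv ℝ θ y (Jm v - S.γ p w • Jm XH + S.γ p (Complex.I * w) • XH) v) +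
    (fderiv ℝ θ y v XH + θ y (fderiv ℝ X y v)) * _ +
    (fderiv ℝ κ y v XH + κ y (fderiv ℝ X y v)) * _ -
    (fderiv ℝ θ y (Jm v - S.γ p w • Jm XH + S.γ p (Complex.I * w) • XH) XH +
      θ y (fderiv ℝ X y (Jm v - S.γ p w • Jm XH + S.γ p (Complex.I * w) • XH))) * _ +
    (fderiv ℝ κ y (Jm v - S.γ p w • Jm XH + S.γ p (Complex.I * w) • XH) XH +
      κ y (fderiv ℝ X y (Jm v - S.γ p w • Jm XH + S.γ p (Complex.I * w) • XH))) * _ at hmain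
  linarith

omit [FiniteDimensional ℝ E] [IsManifold 𝓘(ℝ, E) ∞ M] in
/-- A decomposable function with bounded `f` is proper on the sublevel sets of the family. -/
lemma isCompact_closure_of_decomposable [T2Space M] {H g : M → ℝ}
    (hproper : ∀ C : ℝ, IsProperMap ({m : M | H m ≤ C}.domRestrict g)) {d : ℕ}
    (S : DecoratedPointedDisc d) {f : ℂ → ℝ} {b : ℝ} (hb : ∀ z ∈ S.carrier, |f z| ≤ b)
    {K : Set (M × ℂ)} (hK : IsCompact K) {Φ : Family E M}
    (hΦ : ∀ m, ∀ p ∈ S.carrier, (m, p) ∉ K → Φ.ham p m = H m) (C : ℝ) {T : Set ℝ}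
    (hT : IsCompact T) :
    IsCompact (closure {x : M × ℂ | x.2 ∈ S.carrier ∧ Φ.ham x.2 x.1 ≤ C ∧ f x.2 + g x.1 ∈ T}) := by
  obtain ⟨r, hr⟩ := hT.isBounded.subset_closedBall 0
  have h1 : IsCompact (Subtype.val '' (({m : M | H m ≤ C}.domRestrict g) ⁻¹'
      Icc (-(r + b)) (r + b))) :=
    ((hproper C).isCompact_preimage isCompact_Icc).image continuous_subtype_val
  -- Off `K` the Hamiltonian is `H`, and `|f| ≤ b` confines `g` to a compact interval, so properness
  -- of `g` on `{H ≤ C}` applies.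
  refine (hK.union (h1.prod (isCompact_closedBall (0 : ℂ) 1))).closure_of_subset ?_
  rintro ⟨m, p⟩ ⟨hp, hC, hGT⟩
  by_cases hmem : (m, p) ∈ K
  · exact Or.inl hmem
  · refine Or.inr ⟨⟨⟨m, ?_⟩, ?_, rfl⟩, hp.1⟩
    · exact (hΦ m p hp hmem).ge.trans hC
    · have h2 := hr hGT
      rw [Metric.mem_closedBall, Real.dist_eq, sub_zero, abs_le] at h2
      have h3 := abs_le.1 (hb p hp)
      simp only at h2
      exact ⟨by simp only [domRestrict_apply]; linarith [h2.1, h3.2],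
        by simp only [domRestrict_apply]; linarith [h2.2, h3.1]⟩

end Suppression

end PartialWrapping

end

theorem mainTheorem10
    {E : Type*} [NormedAddCommGroup E] [NormedSpace ℝ E] [FiniteDimensional ℝ E]
    {M : Type*} [TopologicalSpace M] [ChartedSpace E M] [IsManifold 𝓘(ℝ, E) ∞ M] [T2Space M]
    (lam : OneForm E M) (hlam : IsExactSymplectic lam)
    (H g : M → ℝ) (hH : ContMDiff 𝓘(ℝ, E) 𝓘(ℝ, ℝ) ∞ H) (hg : ContMDiff 𝓘(ℝ, E) 𝓘(ℝ, ℝ) ∞ g)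
    (J : EndField E M) (hJ : IsAlmostComplex J)
    (𝒟 : ∀ d : ℕ, Set (DecoratedPointedDisc d)) (L : ℝ)
    (hL : ∀ d : ℕ, ∀ S ∈ 𝒟 d, S.IsBoundedBy L)
    (C₀ C₁ : ℝ) (hC₀ : 0 ≤ C₀) (hC₁ : 0 < C₁)
    (hproper : ∀ C : ℝ, IsProperMap ({m : M | H m ≤ C}.domRestrict g))
    (hconvex : IsJConvex J g)
    (hlie : ∀ m : M, |dfun 𝓘(ℝ, E) univ g m (hamField lam H m)| ≤ C₀ ∧
      dfun 𝓘(ℝ, E) univ g m (J m (hamField lam H m)) ≤ C₀)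
    (hX : ∀ m : M, normBy J g m (hamField lam H m) ≤ C₁)
    (heta : ∀ m : M, CovectorNormLE J g m (eta J g m (hamField lam H m)) C₁)
    (hdg : ∀ m : M, CovectorNormLE J g m
      (lieForm 𝓘(ℝ, E) (hamField lam H) (dfun 𝓘(ℝ, E) univ g) m) C₁)
    (hdcg : ∀ m : M, CovectorNormLE J g m
      (lieForm 𝓘(ℝ, E) (hamField lam H) (dcfun 𝓘(ℝ, E) univ J g) m) C₁) :
    Suppresses lam 𝒟 H J g (C₁ ^ 2 * L + C₀ * L) ∧
      IsPartiallyConvex lam 𝒟 H J (C₁ ^ 2 * L + C₀ * L) := by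
  have key : Suppresses lam 𝒟 H J g (C₁ ^ 2 * L + C₀ * L) := by
    intro d S _
    obtain ⟨f, b, hf, hb, hmax, hlap⟩ := S.exists_subharmonic
      (N := 24 * C₁ ^ 2) (by positivity) C₀ (C₁ ^ 2 * L + C₀ * L)
    -- The neighbourhood is the whole space: the same `f` serves every family, and only `C_G`
    -- depends on `Φ`.
    refine @Eventually.of_forall _ _ (@nhds _ (familyTopology E M S.carrier) _) fun Φ hΦ => ?_
    obtain ⟨K, hK, hKS, hKΦ⟩ := hΦ.support
    have hGK : ContinuousOn (fun x : M × ℂ => f x.2 + g x.1) K :=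
      (hf.continuousOn.comp continuousOn_snd fun x hx => (hKS hx).2).add
        (hg.continuous.comp continuous_fst).continuousOn
    -- Above the level `c` the point lies off the support `K`; taking `max 1 c` makes `C_G`
    -- positive.
    obtain ⟨c, hc⟩ := (hK.image_of_continuousOn hGK).bddAbove
    refine ⟨fun x => f x.2 + g x.1, ⟨f, hf, fun z hz => le_trans ?_ (hlap z hz), hmax,
      fun m p _ => rfl⟩, max 1 c, lt_max_of_lt_left one_pos, fun C =>
      ⟨fun T hT => isCompact_closure_of_decomposable hproper S hb hK
        (fun m p hp hm => (hKΦ m p hp hm).1) C hT, ?_⟩⟩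
    · positivity
    rintro ⟨m, p⟩ hp hcG u
    have hmK : (m, p) ∉ K := fun hm =>
      absurd ((le_max_right 1 c).trans_lt hcG) (not_lt.2 (hc ⟨(m, p), hm, rfl⟩))
    refine omega_gromov_nonneg hlam hH hg hJ S hC₁.le (hconvex m) (hlie m) (hX m) (heta m) (hdg m)
      (hdcg m) hf hp (hlap p hp) (fun _ _ _ => rfl) ?_ u
    filter_upwards [hK.isClosed.isOpen_compl.mem_nhds hmK] with x hxK hxS
    refine ⟨hamField_congr lam ?_, (hKΦ x.1 x.2 hxS hxK).2⟩
    have ho : {m' : M | (m', x.2) ∈ Kᶜ} ∈ 𝓝 x.1 :=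
      (hK.isClosed.isOpen_compl.preimage (Continuous.prodMk_left x.2)).mem_nhds hxK
    filter_upwards [ho] with m' hm'
    exact (hKΦ m' x.2 hxS hm').1
  exact ⟨key, g, hg, key⟩
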